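/- Let $G$ be a group acting without inversions, by simplicial automorphisms, on a simplicial tree $T$, regarded as a metric space in which every edge is isometric to the unit interval. For $g\in G$ let $|g|=\inf_{x\in T}d(x,gx)$ and $T_g=\{x\in T: d(x,gx)=|g|\}$. The element $g$ is elliptic if $|g|=0$ and hyperbolic if $|g|>0$. In the latter case $T_g$ is a line (the axis of $g$), oriented by the direction in which $g$ shifts it, and $T_g/\langle g\rangle$ is an oriented circuit of length $|g|$. Let $\gamma$ be an oriented segment in $T$, whose endpoints need not be vertices, let $\overline{\gamma}$ be the same segment with the opposite orientation, and let $|\gamma|$ be its length. If $g$ is hyperbolic and $|\gamma|\le|g|$, a positively oriented copy of $\gamma$ in $T_g/\langle g\rangle$ is the image of a segment $k\gamma$ ($k\in G$) that is contained in $T_g$ and whose orientation agrees with that of $T_g$; if $|\gamma|>|g|$ there are no copies. Two copies overlap if their intersection contains a non-trivial segment of the circuit. Let $c_\gamma(g)$ be the maximal number of pairwise non-overlapping positively oriented copies of $\gamma$ in $T_g/\langle g\rangle$ if $g$ is hyperbolic, and $c_\gamma(g)=0$ if $g$ is elliptic. Define $$f_\gamma(g)=c_\gamma(g)-c_{\overline{\gamma}}(g),\qquad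 h_\gamma(g)=\lim_{n\to\infty}\frac{f_\gamma(g^n)}{n}.$$ Then the limit defining $h_\gamma(g)$ exists for every $g\in G$, and both $f_\gamma$ and $h_\gamma$ are quasimorphisms on $G$ of defect at most $6$. Here a function $f\colon G\to\mathbb{R}$ is a quasimorphism if there is a number $D$ with $|f(gh)-f(g)-f(h)|\le D$ for all $g,h\in G$, and its defect is the smallest such $D$. -/

import Mathlib

open Filter Topology

namespace TreeQM

noncomputable section

/-- The geometric realization of a simple graph without triangles (here: of a simplicial tree), in
barycentric coordinates: a point is a convex combination of the vertices of a single vertex or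
edge. -/
@[ext]
structure Realization {V : Type*} (Γ : SimpleGraph V) where
  coord : V →₀ ℝ
  nonneg : ∀ v, 0 ≤ coord v
  sum_eq_one : (coord.sum fun _ r => r) = 1
  clique : Γ.IsClique (coord.support : Set V)

variable {V : Type*} {Γ : SimpleGraph V}

open Classical in
/-- The path metric in which every edge is isometric to the unit interval.
If `x` and `y` lie in a common edge, say `x = (1 - s) a + s b` and `y = (1 - t) a + t b`, their
distance is `|s - t|`. Otherwise a shortest path from `x` to `y` first goes to a vertex `u` of the
edge carrying `x` (length `1 - x u`), then to a vertex `v` of the edge carrying `y`, and then to `y`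
(length `1 - y v`). -/
instance instDist : Dist (Realization Γ) where
  dist x y :=
    if Γ.IsClique ((x.coord.support : Set V) ∪ (y.coord.support : Set V)) then
      ((x.coord - y.coord).sum fun _ r => |r|) / 2
    else
      sInf {r : ℝ | ∃ u ∈ x.coord.support, ∃ v ∈ y.coord.support,
        r = (1 - x.coord u) + (Γ.dist u v : ℝ) + (1 - y.coord v)}

/-- Graph automorphisms act on the realization, by affine extension from the vertices. -/
instance instMulAction : MulAction (Γ ≃g Γ) (Realization Γ) where
  smul φ x :=
    { coord := x.coord.equivMapDomain φ.toEquiv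
      nonneg := fun v => x.nonneg _
      sum_eq_one := by
        rw [Finsupp.equivMapDomain_eq_mapDomain,
          Finsupp.sum_mapDomain_index (fun _ => rfl) (fun _ _ _ => rfl)]
        exact x.sum_eq_one
      clique := by
        intro u hu v hv huv
        have hu' : x.coord (φ.symm u) ≠ 0 := by
          have := Finsupp.mem_support_iff.1 (Finset.mem_coe.1 hu)
          rwa [Finsupp.equivMapDomain_apply] at this
        have hv' : x.coord (φ.symm v) ≠ 0 := by
          have := Finsupp.mem_support_iff.1 (Finset.mem_coe.1 hv)
          rwa [Finsupp.equivMapDomain_apply] at this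
        have h := x.clique (Finsupp.mem_support_iff.2 hu') (Finsupp.mem_support_iff.2 hv')
          (fun h => huv (φ.symm.injective h))
        exact φ.symm.map_adj_iff.1 h }
  one_smul x := by
    apply Realization.ext
    exact Finsupp.equivMapDomain_refl _
  mul_smul φ ψ x := by
    apply Realization.ext
    exact Finsupp.equivMapDomain_trans ψ.toEquiv φ.toEquiv x.coord

/-- The segment `[p, q]`: the unique geodesic of the tree joining `p` and `q`. -/
def geodesic (p q : Realization Γ) : Set (Realization Γ) :=
  {x | dist p x + dist x q = dist p q}

/-- An oriented segment of the tree, given by its initial and its terminal endpoint (arbitrary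
points of the tree, not necessarily vertices). -/
structure OrientedSegment (Γ : SimpleGraph V) where
  source : Realization Γ
  target : Realization Γ

namespace OrientedSegment

/-- The underlying subset of the tree. -/
def carrier (γ : OrientedSegment Γ) : Set (Realization Γ) := geodesic γ.source γ.target

def length (γ : OrientedSegment Γ) : ℝ := dist γ.source γ.target

/-- The same segment with the opposite orientation. -/
def reverse (γ : OrientedSegment Γ) : OrientedSegment Γ := ⟨γ.target, γ.source⟩

/-- The image of an oriented segment under an automorphism. -/
def translate (φ : Γ ≃g Γ) (γ : OrientedSegment Γ) : OrientedSegment Γ :=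
  ⟨φ • γ.source, φ • γ.target⟩

end OrientedSegment

/-- The translation length of an automorphism: the infimum of the displacement function on the
realization. -/
def translationLength (φ : Γ ≃g Γ) : ℝ :=
  sInf (Set.range fun x : Realization Γ => dist x (φ • x))

/-- The characteristic subtree: the points of minimal displacement. It is the axis if `φ` is
hyperbolic. -/
def charSubtree (φ : Γ ≃g Γ) : Set (Realization Γ) :=
  {x | dist x (φ • x) = translationLength φ}

def IsHyperbolic (φ : Γ ≃g Γ) : Prop := 0 < translationLength φ

/-- The oriented segment `σ` is contained in the axis of `φ` and its orientation agrees with the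
direction in which `φ` shifts the axis: starting at the initial point `p` of `σ` and moving in the
direction of the points `φ ^ n • p`, one meets the terminal point of `σ`. -/
def IsPositiveInAxis (φ : Γ ≃g Γ) (σ : OrientedSegment Γ) : Prop :=
  σ.carrier ⊆ charSubtree φ ∧ ∃ n : ℕ, σ.target ∈ geodesic σ.source (φ ^ n • σ.source)

/-- The quotient of the tree by the cyclic group generated by `φ`. For hyperbolic `φ` it contains
the circuit, the quotient of the axis of `φ`, as the image of the axis. -/
abbrev CyclicQuotient (φ : Γ ≃g Γ) : Type _ :=
  MulAction.orbitRel.Quotient (Subgroup.zpowers φ) (Realization Γ)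

/-- The projection to the quotient. -/
def proj (φ : Γ ≃g Γ) (x : Realization Γ) : CyclicQuotient φ :=
  Quotient.mk (MulAction.orbitRel (Subgroup.zpowers φ) (Realization Γ)) x

/-- Two subsets of the circuit of `φ` overlap: their intersection contains a non-trivial segment,
that is, the image of a non-trivial segment of the axis. -/
def Overlap (φ : Γ ≃g Γ) (A B : Set (CyclicQuotient φ)) : Prop :=
  ∃ p q : Realization Γ, p ≠ q ∧ geodesic p q ⊆ charSubtree φ ∧
    proj φ '' geodesic p q ⊆ A ∩ B

variable {G : Type*} [Group G]

/-- `A` is a positively oriented copy of `γ` in the circuit of `g`: the image of a positively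
oriented copy of `γ` in the axis of `g`, where `|γ| ≤ |g|`. -/
def IsPositiveCopy (ρ : G →* (Γ ≃g Γ)) (γ : OrientedSegment Γ) (g : G)
    (A : Set (CyclicQuotient (ρ g))) : Prop :=
  γ.length ≤ translationLength (ρ g) ∧
    ∃ k : G, IsPositiveInAxis (ρ g) (γ.translate (ρ k)) ∧
      A = proj (ρ g) '' (γ.translate (ρ k)).carrier

open Classical in
/-- `c_γ(g)`: the maximal number of pairwise non-overlapping positively oriented copies of `γ` in
the circuit of `g` if `g` is hyperbolic, and `0` if `g` is elliptic. -/
def copyCount (ρ : G →* (Γ ≃g Γ)) (γ : OrientedSegment Γ) (g : G) : ℕ :=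
  if IsHyperbolic (ρ g) then
    sSup {n : ℕ | ∃ S : Finset (Set (CyclicQuotient (ρ g))), S.card = n ∧
      (∀ A ∈ S, IsPositiveCopy ρ γ g A) ∧
      ∀ A ∈ S, ∀ B ∈ S, A ≠ B → ¬ Overlap (ρ g) A B}
  else 0

/-- The counting function `f_γ`. -/
def countingFn (ρ : G →* (Γ ≃g Γ)) (γ : OrientedSegment Γ) (g : G) : ℝ :=
  (copyCount ρ γ g : ℝ) - (copyCount ρ γ.reverse g : ℝ)

/-- The homogenization `h_γ(g) = lim f_γ(g ^ n) / n`. -/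
def homogenizedFn (ρ : G →* (Γ ≃g Γ)) (γ : OrientedSegment Γ) (g : G) : ℝ :=
  limUnder atTop fun n : ℕ => countingFn ρ γ (g ^ n) / (n : ℝ)

/-- `D` bounds the failure of `f` to be a homomorphism. -/
def DefectBound (f : G → ℝ) (D : ℝ) : Prop :=
  ∀ g h : G, |f (g * h) - f g - f h| ≤ D

def IsQuasimorphism (f : G → ℝ) : Prop := ∃ D : ℝ, DefectBound f D

/-- The defect of a quasimorphism: the smallest `D` that bounds it. -/
def defect (f : G → ℝ) : ℝ := sInf {D : ℝ | DefectBound f D}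

end

end TreeQM

/-! For points p, q let w(p, q) (`signedCount`) be the maximal number of consecutive translates of γ
along [p, q] minus the same number along [q, p]. This w is G-invariant and antisymmetric, and
cutting a segment at a point changes it by at most 1 (`abs_signedCount_sub_le`).

If x lies on the axis of g, then [x, gx] is a fundamental domain of the circuit, and in either
orientation the circuit holds at most one copy more than [x, gx]. Hence f_γ(g) is within 1 of w(x,
gx) (`abs_countingFn_sub_le`). The property `Approximates` records this, and the bound on the defect
follows from it alone (`Approximates.abs_mul_sub_le_six`). If the characteristic sets of g and h are
joined by a non-trivial bridge [p, q], then gh has the fundamental domain [h⁻¹q, gq], which runs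
through q, p, gp; the two passages along the bridge cancel, and three cuts and three approximations
cost 6. If the sets meet, some common point o makes g⁻¹o, o, ho lie on one segment, in some order:
one cut, 1 each for g and h, and 3 for gh, whose axis may miss o, again give 6.

The sequence w(x, gⁿx) is additive up to 1, so it has a growth rate by Fekete's lemma, and it
differs from n w(x, gx) by at most n - 1. Together with the error 1 of f_γ(gⁿ) this keeps h_γ(g)
within 1 of w(x, gx). So h_γ satisfies `Approximates` with the same constant, and the same lemma
bounds its defect (`exists_tendsto_approximates`).

The argument takes place in a real tree defined by the four point condition. The realization is
shown to be one by writing its metric as a maximum of differences of distances to vertices. -/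

namespace TreeQM

/-! ### Betweenness and medians in real trees -/

/-- A real tree: a geodesic metric space with the four point condition. -/
class IsRTree (X : Type*) [MetricSpace X] : Prop where
  four_point : ∀ x y z w : X,
    dist x y + dist z w ≤ max (dist x z + dist y w) (dist x w + dist y z)
  exists_dist_eq : ∀ (x y : X) (t : ℝ), 0 ≤ t → t ≤ dist x y →
    ∃ z, dist x z = t ∧ dist z y = dist x y - t

namespace IsRTree

variable {X : Type*} [MetricSpace X]

/-- The point `y` lies on the segment `[x, z]`. -/
def Btw (x y z : X) : Prop := dist x y + dist y z = dist x z

theorem Btw.symm {x y z : X} (h : Btw x y z) : Btw z y x := by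
  unfold Btw at *
  rw [dist_comm z y, dist_comm y x, dist_comm z x]; linarith

theorem btw_left (x y : X) : Btw x x y := by simp [Btw]

theorem btw_right (x y : X) : Btw x y y := by simp [Btw]

theorem btw_of_le {x y z : X} (h : dist x y + dist y z ≤ dist x z) : Btw x y z :=
  le_antisymm h (dist_triangle x y z)

theorem Btw.trans_left {a b c d : X} (h : Btw a c d) (h' : Btw a b c) : Btw a b d := by
  unfold Btw at *
  have := dist_triangle b c d
  exact btw_of_le (by linarith)

theorem Btw.trans_right {a b c d : X} (h : Btw a b d) (h' : Btw b c d) : Btw a c d :=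
  (h.symm.trans_left h'.symm).symm

/-- If `c ∈ [a, d]` and `b ∈ [a, c]` then `c ∈ [b, d]`. -/
theorem Btw.right_of {a b c d : X} (h : Btw a c d) (h' : Btw a b c) : Btw b c d := by
  unfold Btw at *
  have := dist_triangle a b d
  exact btw_of_le (by linarith)

/-- If `b ∈ [a, d]` and `c ∈ [b, d]` then `b ∈ [a, c]`. -/
theorem Btw.left_of {a b c d : X} (h : Btw a b d) (h' : Btw b c d) : Btw a b c :=
  (h.symm.right_of h'.symm).symm

theorem btw_smul_iff {G : Type*} [Group G] [MulAction G X] [IsIsometricSMul G X] (g : G)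
    {x y z : X} : Btw (g • x) (g • y) (g • z) ↔ Btw x y z := by
  simp [Btw, dist_smul]

variable [IsRTree X]

theorem four_point' (x y z w : X) :
    dist x y + dist z w ≤ dist x z + dist y w ∨ dist x y + dist z w ≤ dist x w + dist y z :=
  le_max_iff.1 (four_point x y z w)

/-- For equal distances this forces `y = z`, which is the uniqueness of geodesics. -/
theorem btw_of_dist_le {a b y z : X} (hy : Btw a y b) (hz : Btw a z b)
    (h : dist a y ≤ dist a z) : Btw a y z := by
  unfold Btw at *
  have h1 := four_point' a b y z
  rw [dist_comm b z, dist_comm b y] at h1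
  apply btw_of_le
  rcases h1 with h1 | h1 <;> linarith

/-- Local geodesics are geodesics: a nondegenerate overlap `[b, c]` excludes backtracking. -/
theorem Btw.trans_of_ne {a b c d : X} (h : Btw a b c) (h' : Btw b c d) (hbc : b ≠ c) :
    Btw a b d := by
  unfold Btw at *
  have h1 := four_point' a c b d
  have h2 := dist_pos.2 hbc
  rw [dist_comm c b] at h1
  apply btw_of_le
  rcases h1 with h1 | h1 <;> linarith

/-- The distance from `a` to `o` is the Gromov product of `b` and `c` at `a`; the four point
condition then puts `o` on the other two sides. -/
theorem exists_center (a b c : X) : ∃ o, Btw a o b ∧ Btw b o c ∧ Btw a o c := by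
  have t1 := dist_triangle a b c
  have t2 := dist_triangle a c b
  have t3 := dist_triangle b a c
  rw [dist_comm c b] at t2
  rw [dist_comm b a] at t3
  obtain ⟨o, h1, h2⟩ := exists_dist_eq a b ((dist a b + dist a c - dist b c) / 2)
    (by linarith) (by linarith)
  have t4 := dist_triangle a o c
  have t5 := dist_triangle b o c
  have h3 := four_point' o c a b
  rw [dist_comm c b, dist_comm o a, dist_comm c a] at h3
  have h2' := dist_comm b o
  refine ⟨o, ?_, ?_, ?_⟩ <;> apply btw_of_le <;> rcases h3 with h3 | h3 <;> linarith

/-- If two points have `p` on the way from `x`, so does every point between them. -/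
theorem btw_of_btw_of_btw {x p y z₁ z₂ : X} (h₁ : Btw x p z₁) (h₂ : Btw x p z₂)
    (hy : Btw z₁ y z₂) : Btw x p y := by
  unfold Btw at *
  have h3 := four_point' p y z₁ z₂
  have t1 := dist_triangle x y z₁
  have t2 := dist_triangle x y z₂
  rw [dist_comm z₁ y] at hy
  apply btw_of_le
  rcases h3 with h3 | h3 <;> linarith

/-! ### Isometries: characteristic sets, projections and bridges -/

section Action

variable {G : Type*} [Group G] [MulAction G X] [IsIsometricSMul G X]

omit [IsRTree X] in
theorem dist_smul_inv_smul (g : G) (x y : X) : dist (g⁻¹ • x) y = dist x (g • y) := by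
  rw [← dist_smul g, smul_inv_smul]

variable (X) in
/-- The characteristic set of an isometry: its fixed points or its axis. -/
def Ax (g : G) : Set X := {x | dist x (g • g • x) = 2 * dist x (g • x)}

omit [IsRTree X] in
theorem mem_Ax_iff {g : G} {x : X} : x ∈ Ax X g ↔ Btw x (g • x) (g • g • x) := by
  simp only [Ax, Set.mem_ofPred_eq, Btw, dist_smul]
  constructor <;> intro h <;> linarith

omit [IsRTree X] [IsIsometricSMul G X] in
theorem mem_Ax_of_fixed {g : G} {x : X} (h : g • x = x) : x ∈ Ax X g := by
  simp [Ax, h]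

omit [IsRTree X] in
theorem smul_mem_Ax {g : G} {x : X} (h : x ∈ Ax X g) : g • x ∈ Ax X g := by
  simpa only [Ax, Set.mem_ofPred_eq, dist_smul] using h

omit [IsRTree X] in
theorem Ax_inv (g : G) : Ax X g⁻¹ = Ax X g := by
  ext x
  simp only [Ax, Set.mem_ofPred_eq]
  rw [← dist_smul g⁻¹ x (g • x), inv_smul_smul, ← dist_smul g⁻¹ x (g • g • x), inv_smul_smul,
    ← dist_smul g⁻¹ (g⁻¹ • x) (g • x), inv_smul_smul, dist_comm x (g⁻¹ • x), dist_comm x]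

/-- The path `[x, g • x]` followed by its image backtracks at `g • x`, and the amount of
backtracking locates `p`. By `btw_proj`, `p` is the projection of `x`. -/
theorem exists_mem_Ax (g : G) (x : X) :
    ∃ p ∈ Ax X g, dist x (g • x) = 2 * dist x p + dist p (g • p) := by
  have te : dist x (g • g • x) ≤ 2 * dist x (g • x) := by
    have := dist_triangle x (g • x) (g • g • x)
    rw [dist_smul] at this
    linarith
  have key : ∀ p, dist (g • p) x + dist x (g • x) ≤
      max (dist x p + dist x (g • g • x)) (dist p (g • x) + dist x (g • x)) := by
    intro p
    have := four_point (g • p) x (g • x) (g • g • x)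
    rwa [dist_smul, dist_smul, dist_smul, dist_comm p x] at this
  have key2 : ∀ p, dist p (g • p) + dist x (g • x) ≤
      max (dist p (g • x) + dist (g • p) x) (2 * dist x p) := by
    intro p
    have := four_point p (g • p) (g • x) x
    rwa [dist_smul, dist_comm p x, dist_comm (g • x) x, ← two_mul] at this
  rcases le_or_gt (dist x (g • g • x)) (dist x (g • x)) with h | h
  -- At least half of the segment is retraced, so its midpoint coincides with the image of the
  -- midpoint.
  · obtain ⟨m, h1, h2⟩ := exists_dist_eq x (g • x) (dist x (g • x) / 2) (by positivity)
      (by linarith [dist_nonneg (x := x) (y := g • x)])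
    have hm : dist m (g • m) = 0 := by
      have k1 := key m
      have k2 := key2 m
      have := dist_nonneg (x := m) (y := g • m)
      rcases le_max_iff.1 k1 with k1 | k1 <;> rcases le_max_iff.1 k2 with k2 | k2 <;> linarith
    refine ⟨m, mem_Ax_of_fixed (dist_eq_zero.1 hm).symm, ?_⟩
    linarith
  -- The chosen length is the Gromov product of `x` and `g • g • x` at `g • x`, so `g • p` is the
  -- point where the backtracking ends.
  · obtain ⟨p, h1, h2⟩ := exists_dist_eq x (g • x) (dist x (g • x) - dist x (g • g • x) / 2)
      (by linarith) (by linarith [dist_nonneg (x := x) (y := g • g • x)])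
    have t1 := dist_triangle4 x p (g • p) (g • x)
    have t2 := dist_triangle4 x p (g • g • p) (g • g • x)
    have t3 := dist_triangle p (g • p) (g • g • p)
    simp only [dist_smul, dist_comm p x] at t1 t2 t3
    have hp : dist p (g • p) = dist x (g • g • x) - dist x (g • x) := by
      have k1 := key p
      have k2 := key2 p
      rcases le_max_iff.1 k1 with k1 | k1 <;> rcases le_max_iff.1 k2 with k2 | k2 <;> linarith
    refine ⟨p, ?_, by linarith⟩
    simp only [Ax, Set.mem_ofPred_eq]
    linarith

theorem btw_pow {g : G} {p : X} (hp : p ∈ Ax X g) (n : ℕ) :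
    Btw p (g • p) (g ^ (n + 1) • p) := by
  by_cases h : p = g • p
  · rw [← h]; exact btw_left _ _
  induction n with
  | zero => simpa using btw_right p (g • p)
  | succ n ih =>
    have h1 : Btw (g • p) (g • g • p) (g ^ (n + 1 + 1) • p) := by
      rw [pow_succ', mul_smul, btw_smul_iff]; exact ih
    exact (mem_Ax_iff.1 hp).trans_of_ne h1 (fun e => h ((smul_left_cancel g) e)) 

theorem dist_pow_smul {g : G} {p : X} (hp : p ∈ Ax X g) (n : ℕ) :
    dist p (g ^ n • p) = n * dist p (g • p) := by
  induction n with
  | zero => simp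
  | succ n ih =>
    have := btw_pow hp n
    rw [Btw, pow_succ', mul_smul, dist_smul, ih] at this
    rw [pow_succ', mul_smul, ← this]; push_cast; ring

theorem pow_mem_Ax {g : G} {p : X} (hp : p ∈ Ax X g) (n : ℕ) : p ∈ Ax X (g ^ n) := by
  simp only [Ax, Set.mem_ofPred_eq]
  rw [smul_smul, ← pow_add, dist_pow_smul hp, dist_pow_smul hp]; push_cast; ring

/-- The power `g ^ n` moves `p` by exactly `n * dist p (g • p)` and `y` by at most `n * dist y (g •
y)`, while its displacements of `p` and `y` differ by at most `2 * dist p y`. -/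
theorem dist_le_of_mem_Ax {g : G} {p : X} (hp : p ∈ Ax X g) (y : X) :
    dist p (g • p) ≤ dist y (g • y) := by
  have hy : ∀ n : ℕ, dist y (g ^ n • y) ≤ n * dist y (g • y) := by
    intro n
    induction n with
    | zero => simp
    | succ n ih =>
      have := dist_triangle y (g • y) (g ^ (n + 1) • y)
      rw [pow_succ', mul_smul, dist_smul] at this
      rw [pow_succ', mul_smul]; push_cast; linarith
  by_contra! hlt
  obtain ⟨n, hn⟩ := exists_nat_gt (2 * dist p y / (dist p (g • p) - dist y (g • y)))
  rw [div_lt_iff₀ (by linarith)] at hn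
  have h1 := dist_triangle4 p y (g ^ n • y) (g ^ n • p)
  rw [dist_pow_smul hp, dist_smul, dist_comm y p] at h1
  have := hy n
  linarith

theorem dist_eq_of_mem_Ax {g : G} {p q : X} (hp : p ∈ Ax X g) (hq : q ∈ Ax X g) :
    dist p (g • p) = dist q (g • q) :=
  le_antisymm (dist_le_of_mem_Ax hp q) (dist_le_of_mem_Ax hq p)

theorem mem_Ax_of_dist_le {g : G} {p x : X} (hp : p ∈ Ax X g)
    (h : dist x (g • x) ≤ dist p (g • p)) : x ∈ Ax X g := by
  obtain ⟨q, hq, e⟩ := exists_mem_Ax g x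
  have := dist_eq_of_mem_Ax hp hq
  have h0 : dist x q = 0 := by linarith [dist_nonneg (x := x) (y := q)]
  rwa [dist_eq_zero.1 h0]

/-- Far translates of a point of the axis enclose any given point of the axis. -/
theorem exists_btw_pow {g : G} {p y : X} (hp : p ∈ Ax X g) (hy : y ∈ Ax X g)
    (hne : g • p ≠ p) : ∃ N : ℕ, ∀ n ≥ N, Btw (g⁻¹ ^ n • p) y (g ^ n • p) := by
  have hpos : 0 < dist p (g • p) := dist_pos.2 (Ne.symm hne)
  obtain ⟨N, hN⟩ := exists_nat_gt (dist p y / dist p (g • p))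
  refine ⟨N, fun n hn => ?_⟩
  rw [div_lt_iff₀ hpos] at hN
  have hn' : (N : ℝ) * dist p (g • p) ≤ n * dist p (g • p) :=
    mul_le_mul_of_nonneg_right (by exact_mod_cast hn) hpos.le
  -- Both alternatives are at most `2 * n * dist p (g • p)`, the first one by the choice of `N`.
  have k := four_point' p (g ^ n • y) y (g ^ n • p)
  have e := dist_eq_of_mem_Ax hp hy
  have e2 : dist (g⁻¹ ^ n • p) (g ^ n • p) = 2 * (n * dist p (g • p)) := by
    rw [inv_pow, dist_smul_inv_smul, smul_smul, ← pow_add, dist_pow_smul hp]; push_cast; ring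
  apply btw_of_le
  rw [e2, inv_pow, dist_smul_inv_smul]
  simp only [dist_smul, dist_pow_smul hp, dist_comm (g ^ n • y) y, dist_pow_smul hy,
    dist_comm y p, ← e] at k
  rcases k with k | k <;> linarith

/-- The displacement formula puts `p` on the way from `x` to `g • p` and to `g⁻¹ • p`. If `p` is not
fixed, it is then on the way to all farther translates, and `y` lies between two of these. If `p` is
fixed, so is `y`, and `g • x` is as far from both as `x`. -/
theorem btw_proj {g : G} {x p y : X} (hp : p ∈ Ax X g)
    (hx : dist x (g • x) = 2 * dist x p + dist p (g • p)) (hy : y ∈ Ax X g) : Btw x p y := by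
  by_cases hfix : g • p = p
  · have e := dist_eq_of_mem_Ax hp hy
    rw [hfix, dist_self] at e hx
    have hy' : g • y = y := (dist_eq_zero.1 e.symm).symm
    have k := four_point' x (g • x) p y
    have e1 : dist (g • x) y = dist x y := by
      conv_lhs => rw [← hy', dist_smul]
    have e2 : dist (g • x) p = dist x p := by
      conv_lhs => rw [← hfix, dist_smul]
    rw [e1, e2] at k
    apply btw_of_le
    rcases k with k | k <;> linarith
  · have hinv : g⁻¹ • p ≠ p := fun h => hfix (by rw [← h, smul_inv_smul, h])
    have h1 : Btw x p (g • p) := by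
      have := dist_triangle x (g • p) (g • x)
      rw [dist_smul, dist_comm p x] at this
      exact btw_of_le (by linarith)
    have h2 : Btw x p (g⁻¹ • p) := by
      have := dist_triangle (g • x) p x
      rw [dist_comm p x, dist_comm (g • x) x] at this
      apply btw_of_le
      rw [dist_comm x (g⁻¹ • p), dist_comm p (g⁻¹ • p), dist_smul_inv_smul, dist_smul_inv_smul,
        dist_comm p (g • x)]
      linarith
    obtain ⟨N, hN⟩ := exists_btw_pow hp hy hfix
    have hb := hN (N + 1) (by omega)
    have hp' : p ∈ Ax X g⁻¹ := by rwa [Ax_inv]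
    exact btw_of_btw_of_btw (h2.trans_of_ne (btw_pow hp' N) (Ne.symm hinv))
      (h1.trans_of_ne (btw_pow hp N) (Ne.symm hfix)) hb

/-- The projection of `y` lies on the way from `y` to `x` and from `y` to `z`, so it is `y`. -/
theorem Ax_convex {g : G} {x y z : X} (hx : x ∈ Ax X g) (hz : z ∈ Ax X g) (h : Btw x y z) :
    y ∈ Ax X g := by
  obtain ⟨p, hp, e⟩ := exists_mem_Ax g y
  have h1 := btw_proj hp e hx
  have h2 := btw_proj hp e hz
  unfold Btw at *
  have := dist_triangle x p z
  have h0 : dist y p = 0 := by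
    rw [dist_comm x y] at h
    rw [dist_comm x p] at this
    linarith [dist_nonneg (x := y) (y := p)]
  rwa [dist_eq_zero.1 h0]

theorem dist_smul_of_proj {g : G} {x p : X} (hp : p ∈ Ax X g) (h : ∀ y ∈ Ax X g, Btw x p y) :
    dist x (g • x) = 2 * dist x p + dist p (g • p) := by
  obtain ⟨q, hq, e⟩ := exists_mem_Ax g x
  have h1 := h q hq
  have h2 := btw_proj hq e hp
  unfold Btw at h1 h2
  have h3 : dist p q = 0 := by
    rw [dist_comm q p] at h2; linarith [dist_nonneg (x := p) (y := q)]
  rwa [← dist_eq_zero.1 h3] at e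

/-- Two characteristic sets meet or are joined by a bridge. -/
theorem exists_bridge (g h : G) [Nonempty X] : ∃ p ∈ Ax X g, ∃ q ∈ Ax X h,
    dist q (g • q) = 2 * dist q p + dist p (g • p) ∧
    dist p (h • p) = 2 * dist p q + dist q (h • q) := by
  obtain ⟨x⟩ := ‹Nonempty X›
  obtain ⟨b, hb, -⟩ := exists_mem_Ax h x
  obtain ⟨p, hp, e1⟩ := exists_mem_Ax g b
  obtain ⟨q, hq, e2⟩ := exists_mem_Ax h p
  -- `q` lies on `[p, b]`, so the projection `p` of `b` is also the projection of `q`.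
  refine ⟨p, hp, q, hq, dist_smul_of_proj hp fun a ha => ?_, e2⟩
  have h1 := btw_proj hp e1 ha
  have h2 := btw_proj hq e2 hb
  unfold Btw at h1 h2
  have := dist_triangle b q a
  apply btw_of_le
  rw [dist_comm p b, dist_comm q b] at h2
  rw [dist_comm q p]
  linarith

/-- If the characteristic sets of `g` and `h` are joined by a bridge `[p, q]`, the axis of `g * h`
runs through `h⁻¹ q`, `q`, `p`, `g p`, `g q`. -/
theorem mem_Ax_mul_of_bridge {g h : G} {p q : X} (hpq : p ≠ q)
    (hg : dist q (g • q) = 2 * dist q p + dist p (g • p))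
    (hh : dist p (h • p) = 2 * dist p q + dist q (h • q)) :
    h⁻¹ • q ∈ Ax X (g * h) ∧
      dist (h⁻¹ • q) (g • q) = dist (h⁻¹ • q) q + dist q p + dist p (g • p) + dist p q := by
  have a1 : dist (h⁻¹ • p) p = 2 * dist p q + dist q (h • q) := by rw [dist_smul_inv_smul, hh]
  have a2 : dist (h⁻¹ • p) (h⁻¹ • q) = dist p q := dist_smul _ _ _
  have a3 : dist (h⁻¹ • q) q = dist q (h • q) := dist_smul_inv_smul _ _ _
  have a4 : dist (g • p) (g • q) = dist p q := dist_smul _ _ _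
  have c := dist_comm p q
  have hp0 : 0 < dist p q := dist_pos.2 hpq
  have b1 : Btw (h⁻¹ • p) q p := by
    have := dist_triangle (h⁻¹ • p) (h⁻¹ • q) q
    exact btw_of_le (by linarith)
  have b2 : Btw q p (g • q) := by
    have := dist_triangle p (g • p) (g • q)
    exact btw_of_le (by linarith)
  have b3 : Btw (h⁻¹ • p) q (g • q) := b1.trans_of_ne b2 (Ne.symm hpq)
  have t1 := dist_triangle (h⁻¹ • p) (h⁻¹ • q) (g • q)
  have t2 := dist_triangle (h⁻¹ • q) q (g • q)
  have t3 := dist_triangle (h⁻¹ • p) (h⁻¹ • q) q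
  have e1 : Btw (h⁻¹ • p) (h⁻¹ • q) q := btw_of_le (by unfold Btw at b1; linarith)
  have e2 : Btw (h⁻¹ • q) q (g • q) := b3.right_of e1
  have e3 : dist (h⁻¹ • q) (g • q) =
      dist (h⁻¹ • q) q + dist q p + dist p (g • p) + dist p q := by
    unfold Btw at e2 ; linarith
  refine ⟨?_, e3⟩
  have s1 : Btw q (g • p) (g • q) := by
    have := dist_triangle q p (g • p)
    exact btw_of_le (by linarith)
  have s2 : Btw (h⁻¹ • q) (g • p) (g • q) := e2.trans_right s1
  have s3 : Btw (h⁻¹ • p) (h⁻¹ • q) (g • q) := by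
    unfold Btw at b3
    exact btw_of_le (by unfold Btw at *; linarith)
  have s4 : Btw ((g * h) • h⁻¹ • p) ((g * h) • h⁻¹ • q) ((g * h) • g • q) :=
    (btw_smul_iff _).2 s3
  have r1 : (g * h) • h⁻¹ • p = g • p := by simp [mul_smul]
  have r2 : (g * h) • h⁻¹ • q = g • q := by simp [mul_smul]
  rw [r1, r2] at s4
  have hne : g • p ≠ g • q := fun e => hpq (smul_left_cancel g e)
  rw [mem_Ax_iff, r2]
  -- `[h⁻¹ • q, g • q]` and the image of `[h⁻¹ • p, g • q]` under `g * h` overlap in `[g • p, g •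
  -- q]`, a copy of the bridge, and so fit into one geodesic.
  exact (s4.symm.trans_of_ne s2.symm hne.symm).symm

/-- If the characteristic sets of `g` and `h` meet, they meet in a point at which the tripod of
`g⁻¹ x`, `x`, `h x` is degenerate. -/
theorem exists_degenerate_tripod {g h : G} {x : X} (hg : x ∈ Ax X g) (hh : x ∈ Ax X h) :
    ∃ o ∈ Ax X g ∩ Ax X h, Btw (g⁻¹ • o) o (h • o) ∨ Btw o (g⁻¹ • o) (h • o) ∨
      Btw (g⁻¹ • o) (h • o) o := by
  have hg' : x ∈ Ax X g⁻¹ := by rwa [Ax_inv]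
  obtain ⟨o, h1, h2, h3⟩ := exists_center (g⁻¹ • x) x (h • x)
  by_cases e1 : o = g⁻¹ • x
  · exact ⟨x, ⟨hg, hh⟩, Or.inr (Or.inl (e1 ▸ h2))⟩
  by_cases e2 : o = h • x
  · exact ⟨x, ⟨hg, hh⟩, Or.inr (Or.inr (e2 ▸ h1))⟩
  -- When `o` is neither of these ends, replacing `x` by `o` straightens the tripod: `h • x` lies on
  -- `[o, h • o]`, `g⁻¹ • x` on `[o, g⁻¹ • o]`, and `o` on `[g⁻¹ • x, h • x]`.
  have og : o ∈ Ax X g := by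
    rw [← Ax_inv]; exact Ax_convex (smul_mem_Ax hg') hg' h1
  have oh : o ∈ Ax X h := Ax_convex hh (smul_mem_Ax hh) h2
  refine ⟨o, ⟨og, oh⟩, Or.inl ?_⟩
  have k1 : Btw o (h • x) (h • o) :=
    ((mem_Ax_iff.1 hh).right_of h2).left_of ((btw_smul_iff h).2 h2)
  have k2 : Btw o (g⁻¹ • x) (g⁻¹ • o) :=
    ((mem_Ax_iff.1 hg').right_of h1.symm).left_of ((btw_smul_iff g⁻¹).2 h1.symm)
  have k3 : Btw (g⁻¹ • x) o (h • o) := h3.trans_of_ne k1 e2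
  exact (k3.symm.trans_of_ne k2 e1).symm

end Action

end IsRTree

end TreeQM

/-! ### Counting consecutive segments along a geodesic -/

namespace TreeQM

namespace IsRTree

variable {X : Type*} [MetricSpace X]

/-- There are `n` consecutive segments `[s, t]` with `R s t` along the segment `[p, q]`. -/
def Chain (R : X → X → Prop) : ℕ → X → X → Prop
  | 0, _, _ => True
  | n + 1, p, q => ∃ s t, R s t ∧ Chain R n p s ∧ Btw p s q ∧ Btw s t q

/-- The maximal number of consecutive segments `[s, t]` with `R s t` along `[p, q]`. -/
noncomputable def count (R : X → X → Prop) (p q : X) : ℕ := sSup {n | Chain R n p q}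

/-- The difference of the numbers of positive and of negative segments along `[p, q]`. -/
noncomputable def signedCount (R : X → X → Prop) (p q : X) : ℝ :=
  (count R p q : ℝ) - count R q p

theorem signedCount_symm (R : X → X → Prop) (p q : X) :
    signedCount R q p = -signedCount R p q := by
  unfold signedCount; ring

variable {R : X → X → Prop}

theorem Chain.add {a b : ℕ} {p y q : X} (h : Btw p y q) (ha : Chain R a p y)
    (hb : Chain R b y q) : Chain R (a + b) p q := by
  induction b generalizing q with
  | zero =>
    cases a with
    | zero => trivial
    | succ a =>
      obtain ⟨s, t, hR, hc, h1, h2⟩ := ha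
      have h3 := h.right_of h1
      exact ⟨s, t, hR, hc, h.trans_left h1, h3.trans_left h2⟩
  | succ b ih =>
    obtain ⟨s, t, hR, hc, h1, h2⟩ := hb
    exact ⟨s, t, hR, ih (h.left_of h1) hc, h.trans_right h1, h2⟩

theorem Chain.reverse {n : ℕ} {p q : X} (h : Chain R n p q) :
    Chain (fun s t => R t s) n q p := by
  induction n generalizing q with
  | zero => trivial
  | succ n ih =>
    obtain ⟨s, t, hR, hc, h1, h2⟩ := h
    have h3 : Chain (fun s t => R t s) 1 q s :=
      ⟨t, s, hR, trivial, h2.symm, btw_right _ _⟩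
    rw [add_comm]
    exact Chain.add h1.symm h3 (ih hc)

theorem Chain.mono {a n : ℕ} {p q : X} (h : Chain R n p q) (ha : a ≤ n) : Chain R a p q := by
  induction n generalizing q with
  | zero => obtain rfl : a = 0 := by omega
            trivial
  | succ n ih =>
    rcases Nat.lt_or_ge n a with h' | h'
    · obtain rfl : a = n + 1 := by omega
      exact h
    · obtain ⟨s, t, hR, hc, h1, h2⟩ := h
      exact Chain.add (b := 0) h1 (ih hc h') trivial

theorem Chain.smul {G : Type*} [Group G] [MulAction G X] [IsIsometricSMul G X]
    (hR : ∀ (g : G) s t, R s t → R (g • s) (g • t)) (g : G) {n : ℕ} {p q : X}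
    (h : Chain R n p q) : Chain R n (g • p) (g • q) := by
  induction n generalizing q with
  | zero => trivial
  | succ n ih =>
    obtain ⟨s, t, hRst, hc, h1, h2⟩ := h
    exact ⟨g • s, g • t, hR g s t hRst, ih hc, (btw_smul_iff g).2 h1, (btw_smul_iff g).2 h2⟩

variable {m : ℝ}

theorem Chain.mul_le_dist (hm : ∀ s t, R s t → dist s t = m) {n : ℕ} {p q : X}
    (h : Chain R n p q) : n * m ≤ dist p q := by
  induction n generalizing q with
  | zero => simp
  | succ n ih =>
    obtain ⟨s, t, hR, hc, h1, h2⟩ := h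
    have := ih hc
    have := hm s t hR
    unfold Btw at *
    push_cast
    linarith [dist_nonneg (x := t) (y := q)]

/-- The common positive length makes the supremum in `count` a maximum; for an unbounded set `sSup`
would be `0`. -/
theorem bddAbove_chain (hm0 : 0 < m) (hm : ∀ s t, R s t → dist s t = m) (p q : X) :
    BddAbove {n | Chain R n p q} := by
  refine ⟨⌊dist p q / m⌋₊, fun n hn => Nat.le_floor ?_⟩
  rw [le_div_iff₀ hm0]
  exact hn.mul_le_dist hm

theorem chain_count (hm0 : 0 < m) (hm : ∀ s t, R s t → dist s t = m) (p q : X) :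
    Chain R (count R p q) p q :=
  Nat.sSup_mem (s := {n | Chain R n p q}) ⟨0, (trivial : Chain R 0 p q)⟩ (bddAbove_chain hm0 hm p q)

theorem Chain.le_count (hm0 : 0 < m) (hm : ∀ s t, R s t → dist s t = m) {n : ℕ} {p q : X}
    (h : Chain R n p q) : n ≤ count R p q :=
  le_csSup (bddAbove_chain hm0 hm p q) h

theorem count_flip (hm0 : 0 < m) (hm : ∀ s t, R s t → dist s t = m) (p q : X) :
    count (fun s t => R t s) p q = count R q p := by
  have hm' : ∀ s t, (fun s t => R t s) s t → dist s t = m := fun s t h => by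
    rw [dist_comm]; exact hm t s h
  exact le_antisymm ((chain_count hm0 hm' p q).reverse.le_count hm0 hm)
    ((chain_count hm0 hm q p).reverse.le_count hm0 hm')

theorem count_add_le (hm0 : 0 < m) (hm : ∀ s t, R s t → dist s t = m) {p y q : X}
    (h : Btw p y q) : count R p y + count R y q ≤ count R p q :=
  (Chain.add h (chain_count hm0 hm p y) (chain_count hm0 hm y q)).le_count hm0 hm

variable [IsRTree X]

/-- At most one of the consecutive segments has `y` in its interior, and only one needs to be given
up. -/
theorem Chain.split {n : ℕ} {p y q : X} (hy : Btw p y q) (h : Chain R n p q) :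
    ∃ a b, n ≤ a + b + 1 ∧ Chain R a p y ∧ Chain R b y q := by
  induction n generalizing q with
  | zero => exact ⟨0, 0, by omega, trivial, trivial⟩
  | succ n ih =>
    obtain ⟨s, t, hR, hc, h1, h2⟩ := h
    rcases le_total (dist p y) (dist p s) with hle | hle
    · have h3 := btw_of_dist_le hy h1 hle
      obtain ⟨a, b, hn, ha, hb⟩ := ih h3 hc
      exact ⟨a, b + 1, by omega, ha, s, t, hR, hb, h1.right_of h3, h2⟩
    -- Here `y` lies beyond `s`: the `n` earlier segments end before `y`, and the last one is given
    -- up.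
    · have h3 := btw_of_dist_le h1 hy hle
      exact ⟨n, 0, by omega, Chain.add (b := 0) h3 hc trivial, trivial⟩

theorem count_le_add (hm0 : 0 < m) (hm : ∀ s t, R s t → dist s t = m) {p y q : X}
    (h : Btw p y q) : count R p q ≤ count R p y + count R y q + 1 := by
  obtain ⟨a, b, hn, ha, hb⟩ := (chain_count hm0 hm p q).split h
  have := ha.le_count hm0 hm
  have := hb.le_count hm0 hm
  omega

/-- In each direction the count exceeds the sum over the parts by `0` or `1`, so the difference of
the two is off by at most `1`, not `2`. -/
theorem abs_signedCount_sub_le (hm0 : 0 < m) (hm : ∀ s t, R s t → dist s t = m) {p y q : X}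
    (h : Btw p y q) :
    |signedCount R p q - signedCount R p y - signedCount R y q| ≤ 1 := by
  have h1 : ((count R p y + count R y q : ℕ) : ℝ) ≤ count R p q :=
    Nat.cast_le.2 (count_add_le hm0 hm h)
  have h2 : (count R p q : ℝ) ≤ ((count R p y + count R y q + 1 : ℕ) : ℝ) :=
    Nat.cast_le.2 (count_le_add hm0 hm h)
  have h3 : ((count R q y + count R y p : ℕ) : ℝ) ≤ count R q p :=
    Nat.cast_le.2 (count_add_le hm0 hm h.symm)
  have h4 : (count R q p : ℝ) ≤ ((count R q y + count R y p + 1 : ℕ) : ℝ) :=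
    Nat.cast_le.2 (count_le_add hm0 hm h.symm)
  push_cast at *
  unfold signedCount
  rw [abs_le]; constructor <;> linarith

omit [IsRTree X] in
theorem signedCount_self (p : X) : signedCount R p p = 0 := sub_self _

section Action

variable {G : Type*} [Group G] [MulAction G X] [IsIsometricSMul G X]

omit [IsRTree X] in
theorem count_smul (hR : ∀ (g : G) s t, R s t → R (g • s) (g • t)) (g : G) (p q : X) :
    count R (g • p) (g • q) = count R p q := by
  unfold count
  congr 1
  ext n
  refine ⟨fun h => ?_, fun h => Chain.smul hR g h⟩
  simpa using Chain.smul hR g⁻¹ h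

omit [IsRTree X] in
theorem signedCount_smul (hR : ∀ (g : G) s t, R s t → R (g • s) (g • t)) (g : G) (p q : X) :
    signedCount R (g • p) (g • q) = signedCount R p q := by
  unfold signedCount; rw [count_smul hR, count_smul hR]

/-- The number `v` is, up to `1`, the signed count of a fundamental domain of the axis of `g`;
it vanishes if `g` has a fixed point. -/
def Approximates (R : X → X → Prop) (g : G) (v : ℝ) : Prop :=
  ∀ x ∈ Ax X g, (g • x = x → v = 0) ∧ |v - signedCount R x (g • x)| ≤ 1

/-- The geodesic from `x` to `g • x` runs through the projection `p` of `x` and through `g • p`. The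
two cuts cost `2`, the outer pieces are translates traversed in opposite directions and cancel, and
the approximation at `p` costs `1`. -/
theorem Approximates.abs_sub_le_three (hR : ∀ (g : G) s t, R s t → R (g • s) (g • t))
    (hm0 : 0 < m) (hm : ∀ s t, R s t → dist s t = m) {g : G} {v : ℝ}
    (h : Approximates R g v) (x : X) : |v - signedCount R x (g • x)| ≤ 3 := by
  obtain ⟨p, hp, e⟩ := exists_mem_Ax g x
  have t1 := dist_triangle x p (g • x)
  have t2 := dist_triangle p (g • p) (g • x)
  rw [dist_smul, dist_comm p x] at t2
  have b1 : Btw x p (g • x) := btw_of_le (by linarith)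
  have b2 : Btw p (g • p) (g • x) :=
    btw_of_le (by rw [dist_smul, dist_comm p x]; unfold Btw at b1; linarith)
  have c1 := abs_signedCount_sub_le hm0 hm b1
  have c2 := abs_signedCount_sub_le hm0 hm b2
  have c3 := (h p hp).2
  rw [signedCount_smul hR, signedCount_symm R x p] at c2
  rw [abs_le] at *
  constructor <;> linarith

/-- The numbers that approximate the axes of `g`, `h` and `g * h` are additive up to `6`. -/
theorem Approximates.abs_mul_sub_le_six [Nonempty X]
    (hR : ∀ (g : G) s t, R s t → R (g • s) (g • t))
    (hm0 : 0 < m) (hm : ∀ s t, R s t → dist s t = m) {g h : G} {a b c : ℝ}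
    (ha : Approximates R g a) (hb : Approximates R h b) (hc : Approximates R (g * h) c) :
    |c - a - b| ≤ 6 := by
  obtain ⟨p, hp, q, hq, e1, e2⟩ := exists_bridge (X := X) g h
  by_cases hpq : p = q
  · subst hpq
    -- The budget is `1 + 1` for `g` and `h`, `3` for `g * h` because `o` may lie off its axis, and
    -- `1` for the degenerate tripod.
    obtain ⟨o, ⟨og, oh⟩, hdeg⟩ := exists_degenerate_tripod hp hq
    have k1 := (ha o og).2
    have k2 := (hb o oh).2
    have k3 := hc.abs_sub_le_three hR hm0 hm o
    have s1 : signedCount R o (g • o) = signedCount R (g⁻¹ • o) o := by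
      rw [← signedCount_smul hR g (g⁻¹ • o), smul_inv_smul]
    have s2 : signedCount R o ((g * h) • o) = signedCount R (g⁻¹ • o) (h • o) := by
      rw [← signedCount_smul hR g (g⁻¹ • o), smul_inv_smul, mul_smul]
    have k4 : |signedCount R (g⁻¹ • o) (h • o) - signedCount R (g⁻¹ • o) o
        - signedCount R o (h • o)| ≤ 1 := by
      -- By antisymmetry the estimate is the same whichever of the three points is in the middle.
      rcases hdeg with hd | hd | hd
      · exact abs_signedCount_sub_le hm0 hm hd
      · have := abs_signedCount_sub_le hm0 hm hd
        rw [signedCount_symm R (g⁻¹ • o) o] at this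
        rw [abs_le] at *
        constructor <;> linarith
      · have := abs_signedCount_sub_le hm0 hm hd
        rw [signedCount_symm R o (h • o)] at this
        rw [abs_le] at *
        constructor <;> linarith
    rw [s1] at k1
    rw [s2] at k3
    rw [abs_le] at *
    constructor <;> linarith
  -- The budget is `1` for each of the three elements and `1` for each cut at `q`, `p` and `g • p`;
  -- the bridge is traversed once in each direction.
  · obtain ⟨hx, e⟩ := mem_Ax_mul_of_bridge hpq e1 e2
    have k1 := (ha p hp).2
    have k2 := (hb q hq).2
    have k3 := (hc _ hx).2
    have r2 : (g * h) • h⁻¹ • q = g • q := by simp [mul_smul]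
    have s1 : signedCount R q (h • q) = signedCount R (h⁻¹ • q) q := by
      rw [← signedCount_smul hR h (h⁻¹ • q), smul_inv_smul]
    have s2 : signedCount R (g • p) (g • q) = signedCount R p q := signedCount_smul hR g p q
    rw [r2] at k3
    rw [s1] at k2
    have d1 : dist (g • p) (g • q) = dist p q := dist_smul _ _ _
    have t1 := dist_triangle (h⁻¹ • q) q (g • q)
    have t2 := dist_triangle q p (g • q)
    have t3 := dist_triangle p (g • p) (g • q)
    have c1 := abs_signedCount_sub_le hm0 hm
      (btw_of_le (by linarith) : Btw (h⁻¹ • q) q (g • q))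
    have c2 := abs_signedCount_sub_le hm0 hm (btw_of_le (by linarith) : Btw q p (g • q))
    have c3 := abs_signedCount_sub_le hm0 hm (btw_of_le (by linarith) : Btw p (g • p) (g • q))
    rw [s2] at c3
    rw [signedCount_symm R p q] at c2
    rw [abs_le] at *
    constructor <;> linarith

/-- The signed count along the powers of an isometry is quasi-additive. -/
theorem abs_signedCount_pow_sub_le (hR : ∀ (g : G) s t, R s t → R (g • s) (g • t))
    (hm0 : 0 < m) (hm : ∀ s t, R s t → dist s t = m) {g : G} {x : X} (hx : x ∈ Ax X g)
    (k l : ℕ) :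
    |signedCount R x (g ^ (k + l) • x) - signedCount R x (g ^ k • x)
      - signedCount R x (g ^ l • x)| ≤ 1 := by
  have e : signedCount R (g ^ k • x) (g ^ (k + l) • x) = signedCount R x (g ^ l • x) := by
    rw [pow_add, mul_smul, signedCount_smul hR]
  rw [← e]
  apply abs_signedCount_sub_le hm0 hm
  unfold Btw
  rw [dist_pow_smul hx, dist_pow_smul hx, pow_add, mul_smul, dist_smul, dist_pow_smul hx]
  push_cast; ring

end Action

end IsRTree

/-- A quasi-additive sequence has a mean growth rate. -/
theorem exists_tendsto_div_of_quasiadditive {u : ℕ → ℝ}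
    (hu : ∀ k l, |u (k + l) - u k - u l| ≤ 1) :
    ∃ r, Tendsto (fun n : ℕ => u n / n) atTop (𝓝 r) := by
  -- Adding the error turns quasi-additivity into subadditivity, as needed for Fekete's lemma.
  have hsub : Subadditive fun n => u n + 1 := fun k l => by
    have := (abs_le.1 (hu k l)).2
    linarith
  have hlow : ∀ n : ℕ, n * (u 1 - 1) ≤ u n + 1 := by
    intro n
    induction n with
    | zero => have := (abs_le.1 (hu 0 0)).2; simp at this ⊢; linarith
    | succ n ih => have := (abs_le.1 (hu n 1)).1; push_cast; linarith
  have hbdd : BddBelow (Set.range fun n : ℕ => (u n + 1) / n) := by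
    -- The `0` covers the term `n = 0`, where division by zero gives `0`.
    refine ⟨min (u 1 - 1) 0, ?_⟩
    rintro _ ⟨n, rfl⟩
    rcases Nat.eq_zero_or_pos n with rfl | hn
    · simp
    · refine (min_le_left _ _).trans ?_
      have hn' : (0 : ℝ) < n := by exact_mod_cast hn
      simp only
      rw [le_div_iff₀ hn', mul_comm]
      exact hlow n
  have h1 := (hsub.tendsto_lim hbdd).sub tendsto_one_div_atTop_nhds_zero_nat
  refine ⟨_, h1.congr fun n => ?_⟩
  ring

end TreeQM

/-! ### Homogenization, and the axis as a line -/

namespace TreeQM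

namespace IsRTree

variable {X : Type*} [MetricSpace X] [IsRTree X]
  {G : Type*} [Group G] [MulAction G X] [IsIsometricSMul G X]
  {R : X → X → Prop} {m : ℝ}

/-- Only `n` cuts separate `n + 1` fundamental domains. The unit saved here absorbs the error of `f
(g ^ (n + 1))` in the homogenization. -/
theorem abs_signedCount_pow_sub_mul_le (hR : ∀ (g : G) s t, R s t → R (g • s) (g • t))
    (hm0 : 0 < m) (hm : ∀ s t, R s t → dist s t = m) {g : G} {x : X} (hx : x ∈ Ax X g)
    (n : ℕ) :
    |signedCount R x (g ^ (n + 1) • x) - (n + 1) * signedCount R x (g • x)| ≤ n := by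
  induction n with
  | zero => simp
  | succ n ih =>
    have := abs_signedCount_pow_sub_le hR hm0 hm hx (n + 1) 1
    rw [pow_one] at this
    push_cast
    rw [abs_le] at *
    constructor <;> linarith

/-- The homogenization of a function that approximates all axes does so, too. -/
theorem exists_tendsto_approximates [Nonempty X]
    (hR : ∀ (g : G) s t, R s t → R (g • s) (g • t))
    (hm0 : 0 < m) (hm : ∀ s t, R s t → dist s t = m) {f : G → ℝ}
    (hf : ∀ g, Approximates R g (f g)) (g : G) :
    ∃ r, Tendsto (fun n : ℕ => f (g ^ n) / n) atTop (𝓝 r) ∧ Approximates R g r := by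
  obtain ⟨x, hx, -⟩ := exists_mem_Ax g (Classical.arbitrary X)
  obtain ⟨r, hr⟩ := exists_tendsto_div_of_quasiadditive
    (u := fun n => signedCount R x (g ^ n • x)) (abs_signedCount_pow_sub_le hR hm0 hm hx)
  have hdiff : Tendsto (fun n : ℕ => (f (g ^ n) - signedCount R x (g ^ n • x)) / n) atTop
      (𝓝 0) := by
    apply squeeze_zero_norm _ tendsto_one_div_atTop_nhds_zero_nat
    intro n
    rw [norm_div, Real.norm_eq_abs, Real.norm_natCast]
    gcongr
    exact ((hf (g ^ n)) x (pow_mem_Ax hx n)).2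
  have ht : Tendsto (fun n : ℕ => f (g ^ n) / n) atTop (𝓝 r) := by
    have := hr.add hdiff
    rw [add_zero] at this
    refine this.congr fun n => ?_
    ring
  refine ⟨r, ht, fun y hy => ⟨fun hfix => ?_, ?_⟩⟩
  · have h0 : ∀ n : ℕ, f (g ^ n) = 0 := by
      intro n
      refine ((hf (g ^ n)) y (pow_mem_Ax hy n)).1 ?_
      induction n with
      | zero => simp
      | succ n ih => rw [pow_succ, mul_smul, hfix, ih]
    simp only [h0, zero_div] at ht
    exact tendsto_nhds_unique ht tendsto_const_nhds
  -- The `n` cuts and the error `1` of `f (g ^ (n + 1))` add up to `n + 1`, so division restores the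
  -- constant `1`.
  · have hb : ∀ᶠ n : ℕ in atTop, |f (g ^ n) / n - signedCount R y (g • y)| ≤ 1 := by
      filter_upwards [eventually_ge_atTop 1] with n hn
      obtain ⟨n, rfl⟩ := Nat.exists_eq_add_of_le' hn
      have h1 := abs_signedCount_pow_sub_mul_le hR hm0 hm hy n
      have h2 := ((hf (g ^ (n + 1))) y (pow_mem_Ax hy (n + 1))).2
      have hpos : (0 : ℝ) < n + 1 := by positivity
      push_cast
      rw [div_sub' hpos.ne', abs_div, abs_of_pos hpos, div_le_one hpos]
      rw [abs_le] at *
      constructor <;> linarith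
    exact le_of_tendsto ((ht.sub_const _).abs) hb

theorem dist_zpow_smul {g : G} {x : X} (hx : x ∈ Ax X g) {a b : ℤ} (hab : a ≤ b) :
    dist (g ^ a • x) (g ^ b • x) = (b - a) * dist x (g • x) := by
  obtain ⟨n, rfl⟩ := Int.le.dest hab
  rw [zpow_add, mul_smul, dist_smul, zpow_natCast, dist_pow_smul hx]
  push_cast; ring

/-- The axis of a fixed point free isometry is a line on which it acts as a shift. -/
theorem exists_line {g : G} {x : X} (hx : x ∈ Ax X g) (hne : g • x ≠ x) :
    ∃ l : ℝ → X, Isometry l ∧ l 0 = x ∧ (∀ t, l (t + dist x (g • x)) = g • l t) ∧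
      Set.range l = Ax X g := by
  set L := dist x (g • x) with hL
  have hLpos : 0 < L := dist_pos.2 (Ne.symm hne)
  have hex : ∀ s : ℝ, ∃ z, 0 ≤ s → s ≤ 1 → dist x z = s * L ∧ dist z (g • x) = L - s * L := by
    intro s
    by_cases hs : 0 ≤ s ∧ s ≤ 1
    · obtain ⟨z, hz⟩ := exists_dist_eq x (g • x) (s * L) (mul_nonneg hs.1 hLpos.le)
        (by nlinarith [hs.2])
      exact ⟨z, fun _ _ => hz⟩
    · exact ⟨x, fun h1 h2 => absurd ⟨h1, h2⟩ hs⟩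
  choose pt hpt using hex
  -- The axis is tiled by the translates of a parametrized segment `[x, g • x]`.
  let l : ℝ → X := fun t => g ^ ⌊t / L⌋ • pt (Int.fract (t / L))
  have hfl : ∀ t, t / L * L = t := fun t => div_mul_cancel₀ t hLpos.ne'
  -- `l t` has position `t` relative to all translates of `x` on either side. Points of one geodesic
  -- are determined by their positions, which gives both the isometry and the range.
  have key : ∀ (t : ℝ) (N M : ℤ), N ≤ ⌊t / L⌋ → ⌊t / L⌋ + 1 ≤ M →
      dist (g ^ N • x) (l t) = t - N * L ∧ dist (l t) (g ^ M • x) = M * L - t := by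
    intro t N M hN hM
    set k := ⌊t / L⌋ with hk
    obtain ⟨p1, p2⟩ := hpt (Int.fract (t / L)) (Int.fract_nonneg _) (Int.fract_lt_one _).le
    have e : Int.fract (t / L) * L = t - k * L := by
      rw [Int.fract, sub_mul, hfl]
    have d1 : dist (g ^ k • x) (l t) = t - k * L := by
      rw [← e, ← p1]; exact dist_smul _ _ _
    have d2 : dist (l t) (g ^ (k + 1) • x) = L - (t - k * L) := by
      rw [← e, ← p2, zpow_add_one, mul_smul]; exact dist_smul _ _ _
    have c1 := dist_zpow_smul hx hN
    have c2 := dist_zpow_smul hx hM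
    have c3 := dist_zpow_smul hx (show N ≤ M by omega)
    have t1 := dist_triangle (g ^ N • x) (g ^ k • x) (l t)
    have t2 := dist_triangle (l t) (g ^ (k + 1) • x) (g ^ M • x)
    have t3 := dist_triangle (g ^ N • x) (l t) (g ^ M • x)
    push_cast at c2
    constructor <;> linarith
  have hbtw : ∀ (t : ℝ) (N M : ℤ), N ≤ ⌊t / L⌋ → ⌊t / L⌋ + 1 ≤ M →
      Btw (g ^ N • x) (l t) (g ^ M • x) := by
    intro t N M hN hM
    obtain ⟨k1, k2⟩ := key t N M hN hM
    rw [Btw, k1, k2, dist_zpow_smul hx (show N ≤ M by omega)]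
    ring
  have hdist : ∀ s t, s ≤ t → dist (l s) (l t) = t - s := by
    intro s t hst
    have hN : ⌊s / L⌋ ≤ ⌊t / L⌋ := Int.floor_le_floor (by gcongr)
    have hs := key s ⌊s / L⌋ (⌊t / L⌋ + 1) le_rfl (by omega)
    have ht := key t ⌊s / L⌋ (⌊t / L⌋ + 1) hN le_rfl
    have := btw_of_dist_le (hbtw s ⌊s / L⌋ (⌊t / L⌋ + 1) le_rfl (by omega))
      (hbtw t ⌊s / L⌋ (⌊t / L⌋ + 1) hN le_rfl) (by rw [hs.1, ht.1]; linarith)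
    rw [Btw, hs.1, ht.1] at this
    linarith
  have hiso : Isometry l := by
    refine Isometry.of_dist_eq fun s t => ?_
    rcases le_total s t with h | h
    · rw [hdist s t h, Real.dist_eq, abs_sub_comm, abs_of_nonneg (by linarith)]
    · rw [dist_comm, hdist t s h, Real.dist_eq, abs_of_nonneg (by linarith)]
  have hshift : ∀ t, l (t + L) = g • l t := by
    intro t
    have : (t + L) / L = t / L + 1 := by field_simp
    simp only [l, this, Int.floor_add_one, Int.fract_add_one]
    rw [add_comm, zpow_add, mul_smul, zpow_one]
  refine ⟨l, hiso, ?_, hshift, ?_⟩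
  · have := (key 0 0 1 (by simp) (by simp)).1
    simpa using (dist_eq_zero.1 (by simpa using this)).symm
  · ext y
    constructor
    · rintro ⟨t, rfl⟩
      simp only [Ax, Set.mem_ofPred_eq]
      rw [← hshift, ← hshift, hdist _ _ (by linarith), hdist _ _ (by linarith)]
      ring
    · intro hy
      obtain ⟨n, hn⟩ := exists_btw_pow hx hy hne
      have hb := hn (n + 1) (by omega)
      set N : ℤ := n + 1 with hNdef
      have z1 : g⁻¹ ^ (n + 1) • x = g ^ (-N) • x := by
        rw [hNdef, inv_pow, zpow_neg]; norm_cast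
      have z2 : g ^ (n + 1) • x = g ^ N • x := by rw [hNdef]; norm_cast
      rw [z1, z2] at hb
      set t := dist (g ^ (-N) • x) y - N * L with ht
      have hNN := dist_zpow_smul hx (show -N ≤ N by omega)
      have hb' : dist (g ^ (-N) • x) y + dist y (g ^ N • x) = 2 * (N * L) := by
        rw [hb, hNN]; push_cast; ring
      have hd1 := dist_nonneg (x := g ^ (-N) • x) (y := y)
      have hd2 := dist_nonneg (x := y) (y := g ^ N • x)
      -- For `y = g ^ N • x` the floor is `N`, and `key` needs an end beyond it; hence the wider
      -- interval with `N + 1`.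
      have h1 : -(N + 1) ≤ ⌊t / L⌋ := by
        rw [Int.le_floor, le_div_iff₀ hLpos]; push_cast; linarith
      have h2 : ⌊t / L⌋ + 1 ≤ N + 1 := by
        have : (⌊t / L⌋ : ℝ) ≤ N := (Int.floor_le _).trans (by
          rw [div_le_iff₀ hLpos]; linarith)
        have : ⌊t / L⌋ ≤ N := by exact_mod_cast this
        omega
      have k := key t (-(N + 1)) (N + 1) h1 h2
      have b := hbtw t (-(N + 1)) (N + 1) h1 h2
      have hb2 := hn (n + 1 + 1) (by omega)
      have z3 : g⁻¹ ^ (n + 1 + 1) • x = g ^ (-(N + 1)) • x := by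
        rw [hNdef, inv_pow, zpow_neg]; norm_cast
      have z4 : g ^ (n + 1 + 1) • x = g ^ (N + 1) • x := by rw [hNdef]; norm_cast
      rw [z3, z4] at hb2
      have hN2 := dist_zpow_smul hx (show -(N + 1) ≤ N + 1 by omega)
      have t1 := dist_triangle (g ^ (-(N + 1)) • x) (g ^ (-N) • x) y
      have t2 := dist_triangle y (g ^ N • x) (g ^ (N + 1) • x)
      have c1 := dist_zpow_smul hx (show -(N + 1) ≤ -N by omega)
      have c2 := dist_zpow_smul hx (show N ≤ N + 1 by omega)
      push_cast at *
      have hpos : dist (g ^ (-(N + 1)) • x) y = t + (N + 1) * L := by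
        unfold Btw at hb2
        linarith
      have := btw_of_dist_le hb2 b (by rw [k.1]; linarith)
      rw [Btw, k.1, hpos] at this
      exact ⟨t, (dist_eq_zero.1 (by linarith)).symm⟩

end IsRTree

end TreeQM

/-! ### Combinatorial distance in a tree -/

namespace SimpleGraph

variable {V : Type*} {Γ : SimpleGraph V}

theorem Connected.exists_adj_dist_eq (hΓ : Γ.Connected) {u v : V} {n : ℕ}
    (h : Γ.dist u v = n + 1) : ∃ w, Γ.Adj u w ∧ Γ.dist w v = n := by
  obtain ⟨p, hp⟩ := hΓ.exists_walk_length_eq_dist u v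
  rw [h] at hp
  cases p with
  | nil => simp at hp
  | cons hadj p =>
    rename_i w
    refine ⟨w, hadj, ?_⟩
    have h1 := dist_le p
    have h2 := hΓ.dist_triangle (u := u) (v := w) (w := v)
    rw [dist_eq_one_iff_adj.2 hadj] at h2
    simp only [Walk.length_cons] at hp
    omega

/-- The only edge joining the two sides of an edge of a tree is that edge. -/
theorem IsTree.eq_of_adj_of_dist (hΓ : Γ.IsTree) {a b c d : V} (hab : Γ.Adj a b)
    (hcd : Γ.Adj c d) (hc : Γ.dist c b = Γ.dist c a + 1) (hd : Γ.dist d a = Γ.dist d b + 1) :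
    c = a ∧ d = b := by
  have h1 := hΓ.dist_eq_dist_add_one_of_adj a hcd
  have h2 := hΓ.dist_eq_dist_add_one_of_adj b hcd
  simp only [dist_comm (u := a), dist_comm (u := b)] at h1 h2
  have hij : Γ.dist c a = Γ.dist d b := by omega
  obtain ⟨p, hp⟩ := hΓ.connected.exists_walk_length_eq_dist c a
  obtain ⟨q, hq⟩ := hΓ.connected.exists_walk_length_eq_dist d b
  have w1 : (Walk.cons hcd.symm p).IsPath :=
    Walk.isPath_of_length_eq_dist _ (by rw [Walk.length_cons]; omega)
  have w2 : (q.concat hab.symm).IsPath :=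
    Walk.isPath_of_length_eq_dist _ (by rw [Walk.length_concat]; omega)
  -- Both are paths from `d` to `a`, so they agree and the first one visits `b`. It can do so only
  -- at `d`, because `b` is farther from `c` than `a` is.
  have e : Walk.cons hcd.symm p = q.concat hab.symm := by
    have := (hΓ.isAcyclic.subsingleton_path d a).elim ⟨_, w1⟩ ⟨_, w2⟩
    exact congrArg Subtype.val this
  have hb : b ∈ (Walk.cons hcd.symm p).support := by
    rw [e, Walk.support_concat]; simp
  rw [Walk.support_cons, List.mem_cons] at hb
  classical
  rcases hb with rfl | hb
  · rw [dist_self] at hij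
    exact ⟨hΓ.connected.dist_eq_zero_iff.1 hij, rfl⟩
  · have k1 := dist_le (p.takeUntil b hb)
    have k2 := p.length_takeUntil_le_length hb
    omega

/-- A shortest path from `u` to `v` changes sides of the edge, and by `IsTree.eq_of_adj_of_dist` it
can do so only across the edge itself. -/
theorem IsTree.dist_eq_of_separated (hΓ : Γ.IsTree) {a b u v : V} (hab : Γ.Adj a b)
    (hu : Γ.dist u b = Γ.dist u a + 1) (hv : Γ.dist v a = Γ.dist v b + 1) :
    Γ.dist u v = Γ.dist u a + 1 + Γ.dist b v := by
  have key : ∀ n u, Γ.dist u b = Γ.dist u a + 1 → Γ.dist u v = n →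
      Γ.dist u a + 1 + Γ.dist b v ≤ n := by
    intro n
    induction n with
    | zero =>
      intro u hu huv
      obtain rfl := hΓ.connected.dist_eq_zero_iff.1 huv
      omega
    | succ n ih =>
      intro u hu huv
      obtain ⟨w, huw, hw⟩ := hΓ.connected.exists_adj_dist_eq huv
      rcases hΓ.dist_eq_dist_add_one_of_adj w hab with h | h
      · obtain ⟨rfl, rfl⟩ := hΓ.eq_of_adj_of_dist hab huw hu h
        rw [dist_self]; omega
      · have := ih w h hw
        have := hΓ.connected.dist_triangle (u := u) (v := w) (w := a)
        rw [dist_eq_one_iff_adj.2 huw] at this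
        omega
  have h1 := key _ u hu rfl
  have h2 := hΓ.connected.dist_triangle (u := u) (v := a) (w := v)
  have h3 := hΓ.connected.dist_triangle (u := a) (v := b) (w := v)
  rw [dist_eq_one_iff_adj.2 hab] at h3
  omega

/-- Move `x` one step towards `y`. If `z` and `w` are on the far side of that edge, the distances
from `x` to all three points drop by one. If one of them is on the near side, its geodesic to `y`
runs through `x`, and the triangle inequality suffices. -/
theorem IsTree.four_point (hΓ : Γ.IsTree) (x y z w : V) :
    Γ.dist x y + Γ.dist z w ≤ max (Γ.dist x z + Γ.dist y w) (Γ.dist x w + Γ.dist y z) := by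
  induction hn : Γ.dist x y generalizing x with
  | zero =>
    obtain rfl := hΓ.connected.dist_eq_zero_iff.1 hn
    have := hΓ.connected.dist_triangle (u := z) (v := x) (w := w)
    rw [dist_comm (u := z) (v := x)] at this
    exact le_max_of_le_left (by omega)
  | succ n ih =>
    obtain ⟨x', hx, hx'⟩ := hΓ.connected.exists_adj_dist_eq hn
    have hy : Γ.dist y x = Γ.dist y x' + 1 := by
      rw [dist_comm, hn, dist_comm, hx']
    have aux : ∀ z, Γ.dist z x' = Γ.dist z x + 1 → Γ.dist y z = n + 1 + Γ.dist x z := by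
      intro z hz
      have := hΓ.dist_eq_of_separated hx hz hy
      rw [dist_comm (u := y), dist_comm (u := x)]
      omega
    have hzw := hΓ.connected.dist_triangle (u := z) (v := x) (w := w)
    rw [dist_comm (u := z) (v := x)] at hzw
    rcases hΓ.dist_eq_dist_add_one_of_adj z hx with hz | hz
    · rcases hΓ.dist_eq_dist_add_one_of_adj w hx with hw | hw
      · have := ih x' hx'
        simp only [dist_comm (u := z) (v := x), dist_comm (u := z) (v := x'),
          dist_comm (u := w) (v := x), dist_comm (u := w) (v := x')] at hz hw
        omega
      · have := aux w hw
        exact le_max_of_le_left (by omega)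
    · have := aux z hz
      exact le_max_of_le_right (by omega)

theorem Connected.dist_map_le {W : Type*} {Δ : SimpleGraph W} (hΓ : Γ.Connected) (φ : Γ →g Δ)
    (u v : V) : Δ.dist (φ u) (φ v) ≤ Γ.dist u v := by
  obtain ⟨p, hp⟩ := hΓ.exists_walk_length_eq_dist u v
  rw [← hp, ← Walk.length_map φ p]
  exact dist_le _

theorem Connected.dist_map_iso (hΓ : Γ.Connected) (φ : Γ ≃g Γ) (u v : V) :
    Γ.dist (φ u) (φ v) = Γ.dist u v := by
  refine le_antisymm (hΓ.dist_map_le φ.toHom u v) ?_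
  simpa using hΓ.dist_map_le φ.symm.toHom (φ u) (φ v)

theorem IsTree.card_le_two_of_isClique (hΓ : Γ.IsTree) {s : Finset V}
    (hs : Γ.IsClique (s : Set V)) : s.card ≤ 2 := by
  by_contra! h
  obtain ⟨a, b, c, ha, hb, hc, hab, hac, hbc⟩ := Finset.two_lt_card_iff.1 h
  refine hΓ.dist_ne_of_adj a (hs hb hc hbc) ?_
  rw [dist_eq_one_iff_adj.2 (hs ha hb hab), dist_eq_one_iff_adj.2 (hs ha hc hac)]

end SimpleGraph

/-! ### The realization of a tree is a real tree -/

namespace TreeQM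

namespace Realization

open SimpleGraph

variable {V : Type*} {Γ : SimpleGraph V}

/-- The affine extension to the realization of the distance to the vertex `v`. -/
noncomputable def vertexDist (x : Realization Γ) (v : V) : ℝ :=
  x.coord.sum fun u r => r * (Γ.dist u v : ℝ)

/-- A vertex as a point of the realization. -/
noncomputable def vertex (Γ : SimpleGraph V) (a : V) : Realization Γ where
  coord := Finsupp.single a 1
  nonneg v := by
    classical
    rw [Finsupp.single_apply]; split_ifs <;> simp
  sum_eq_one := by simp
  clique := by
    rw [Finsupp.support_single _ one_ne_zero, Finset.coe_singleton]
    exact Set.pairwise_singleton _ _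

/-- The point of the edge `{a, b}` with coordinate `r` at `a`. -/
noncomputable def edgePoint {a b : V} (hab : Γ.Adj a b) (r : ℝ) (h0 : 0 ≤ r) (h1 : r ≤ 1) :
    Realization Γ where
  coord := Finsupp.single a r + Finsupp.single b (1 - r)
  nonneg v := by
    classical
    simp only [Finsupp.add_apply, Finsupp.single_apply]
    split_ifs <;> linarith
  sum_eq_one := by
    rw [Finsupp.sum_add_index' (by simp) (by simp), Finsupp.sum_single_index rfl,
      Finsupp.sum_single_index rfl, add_sub_cancel]
  clique := by
    classical
    have : (((Finsupp.single a r + Finsupp.single b (1 - r)).support : Finset V) : Set V) ⊆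
        {a, b} := by
      intro v hv
      rcases Finset.mem_union.1 (Finsupp.support_add (Finset.mem_coe.1 hv)) with h | h
      · exact Or.inl (Finset.mem_singleton.1 (Finsupp.support_single_subset h))
      · exact Or.inr (Finset.mem_singleton.1 (Finsupp.support_single_subset h))
    exact Set.Pairwise.mono this (isClique_pair.2 fun _ => hab)

theorem vertexDist_of_subset {x : Realization Γ} {a b : V} (hab : a ≠ b)
    (hx : (x.coord.support : Set V) ⊆ {a, b}) (v : V) :
    vertexDist x v = x.coord a * Γ.dist a v + x.coord b * Γ.dist b v := by
  classical
  have : x.coord.support ⊆ {a, b} := by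
    intro u hu; simpa using hx hu
  rw [vertexDist, Finsupp.sum_of_support_subset _ this _ (by simp), Finset.sum_pair hab]

theorem coord_add_of_subset {x : Realization Γ} {a b : V} (hab : a ≠ b)
    (hx : (x.coord.support : Set V) ⊆ {a, b}) : x.coord a + x.coord b = 1 := by
  classical
  have : x.coord.support ⊆ {a, b} := by
    intro u hu; simpa using hx hu
  rw [← x.sum_eq_one, Finsupp.sum_of_support_subset _ this _ (by simp), Finset.sum_pair hab]

theorem dist_of_isClique {x y : Realization Γ}
    (h : Γ.IsClique ((x.coord.support : Set V) ∪ (y.coord.support : Set V))) :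
    dist x y = ((x.coord - y.coord).sum fun _ r => |r|) / 2 := if_pos h

theorem dist_of_not_isClique {x y : Realization Γ}
    (h : ¬ Γ.IsClique ((x.coord.support : Set V) ∪ (y.coord.support : Set V))) :
    dist x y = sInf {r : ℝ | ∃ u ∈ x.coord.support, ∃ v ∈ y.coord.support,
      r = (1 - x.coord u) + (Γ.dist u v : ℝ) + (1 - y.coord v)} := if_neg h

theorem dist_of_subset {x y : Realization Γ} {a b : V} (hab : Γ.Adj a b)
    (hx : (x.coord.support : Set V) ⊆ {a, b}) (hy : (y.coord.support : Set V) ⊆ {a, b}) :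
    dist x y = |x.coord a - y.coord a| := by
  classical
  have hx' : x.coord.support ⊆ {a, b} := by
    intro u hu; simpa using hx hu
  have hy' : y.coord.support ⊆ {a, b} := by
    intro u hu; simpa using hy hu
  have hc : Γ.IsClique ((x.coord.support : Set V) ∪ (y.coord.support : Set V)) :=
    Set.Pairwise.mono (Set.union_subset hx hy) (isClique_pair.2 fun _ => hab)
  have h1 := coord_add_of_subset hab.ne hx
  have h2 := coord_add_of_subset hab.ne hy
  have hs : (x.coord - y.coord).support ⊆ {a, b} :=
    Finsupp.support_sub.trans (Finset.union_subset hx' hy')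
  rw [dist_of_isClique hc, Finsupp.sum_of_support_subset _ hs _ (by simp), Finset.sum_pair hab.ne,
    Finsupp.sub_apply, Finsupp.sub_apply,
    show x.coord b - y.coord b = -(x.coord a - y.coord a) by linarith, abs_neg]
  ring

theorem coord_vertex_self (a : V) : (vertex Γ a).coord a = 1 := Finsupp.single_eq_same

theorem support_vertex (a : V) : (vertex Γ a).coord.support = {a} :=
  Finsupp.support_single _ one_ne_zero

theorem vertexDist_vertex (a v : V) : vertexDist (vertex Γ a) v = Γ.dist a v := by
  simp [vertexDist, vertex]

theorem coord_le_one (x : Realization Γ) (u : V) : x.coord u ≤ 1 := by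
  by_cases hu : u ∈ x.coord.support
  · rw [← x.sum_eq_one]
    exact Finset.single_le_sum (f := fun v => x.coord v) (fun v _ => x.nonneg v) hu
  · rw [Finsupp.notMem_support_iff.1 hu]; exact zero_le_one

theorem coord_pos {x : Realization Γ} {u : V} (hu : u ∈ x.coord.support) : 0 < x.coord u :=
  lt_of_le_of_ne (x.nonneg u) (Ne.symm (Finsupp.mem_support_iff.1 hu))

theorem eq_vertex_of_support {x : Realization Γ} {a : V} (h : x.coord.support = {a}) :
    x = vertex Γ a := by
  have h1 : x.coord a = 1 := by
    rw [← x.sum_eq_one, Finsupp.sum, h, Finset.sum_singleton]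
  ext v
  by_cases hv : v = a
  · rw [hv, h1, coord_vertex_self]
  · have h2 : v ∉ x.coord.support := by rw [h]; simpa using hv
    have h3 : v ∉ (vertex Γ a).coord.support := by rw [support_vertex]; simpa using hv
    rw [Finsupp.notMem_support_iff.1 h2, Finsupp.notMem_support_iff.1 h3]

theorem exists_support_eq_of_isTree (hΓ : Γ.IsTree) {s : Finset V} (hs : Γ.IsClique (s : Set V))
    (hne : s.Nonempty) : (∃ a, s = {a}) ∨ ∃ a b, Γ.Adj a b ∧ (s : Set V) = {a, b} := by
  classical
  have h2 := hΓ.card_le_two_of_isClique hs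
  have h1 := hne.card_pos
  obtain h | h : s.card = 1 ∨ s.card = 2 := by omega
  · exact Or.inl (Finset.card_eq_one.1 h)
  · obtain ⟨a, b, hab, rfl⟩ := Finset.card_eq_two.1 h
    exact Or.inr ⟨a, b, hs (by simp) (by simp) hab, by simp⟩

theorem support_nonempty (x : Realization Γ) : x.coord.support.Nonempty := by
  by_contra h
  have := x.sum_eq_one
  rw [Finsupp.sum, Finset.not_nonempty_iff_eq_empty.1 h, Finset.sum_empty] at this
  exact zero_ne_one this

theorem vertex_or_edge (hΓ : Γ.IsTree) (x : Realization Γ) :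
    (∃ a, x = vertex Γ a) ∨ ∃ a b, Γ.Adj a b ∧ (x.coord.support : Set V) = {a, b} := by
  rcases exists_support_eq_of_isTree hΓ x.clique x.support_nonempty with ⟨a, h⟩ | h
  · exact Or.inl ⟨a, eq_vertex_of_support h⟩
  · exact Or.inr h

theorem eq_or_edge_of_isClique (hΓ : Γ.IsTree) {x y : Realization Γ}
    (h : Γ.IsClique ((x.coord.support : Set V) ∪ (y.coord.support : Set V))) :
    x = y ∨ ∃ a b, Γ.Adj a b ∧ (x.coord.support : Set V) ⊆ {a, b} ∧
      (y.coord.support : Set V) ⊆ {a, b} := by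
  classical
  rw [← Finset.coe_union] at h
  rcases exists_support_eq_of_isTree hΓ h (x.support_nonempty.mono Finset.subset_union_left) with
    ⟨a, e⟩ | ⟨a, b, hab, e⟩
  · left
    have h1 : x.coord.support = {a} := (Finset.Nonempty.subset_singleton_iff
      x.support_nonempty).1 (e ▸ Finset.subset_union_left)
    have h2 : y.coord.support = {a} := (Finset.Nonempty.subset_singleton_iff
      y.support_nonempty).1 (e ▸ Finset.subset_union_right)
    rw [eq_vertex_of_support h1, eq_vertex_of_support h2]
  · right
    rw [Finset.coe_union] at e
    exact ⟨a, b, hab, e ▸ Set.subset_union_left, e ▸ Set.subset_union_right⟩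

theorem cast_dist_eq_add_one (hΓ : Γ.IsTree) (u : V) {a b : V} (hab : Γ.Adj a b) :
    (Γ.dist a u : ℝ) = Γ.dist b u + 1 ∨ (Γ.dist b u : ℝ) = Γ.dist a u + 1 := by
  have := hΓ.dist_eq_dist_add_one_of_adj u hab
  rw [dist_comm (v := a), dist_comm (v := b)] at this
  exact_mod_cast this

/-- The way from `y` to `e` leaves the edge of `y` through its end `v` nearer to `e`. -/
theorem exists_vertexDist_eq (hΓ : Γ.IsTree) (y : Realization Γ) (e : V) :
    ∃ v ∈ y.coord.support, vertexDist y e = Γ.dist v e + (1 - y.coord v) := by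
  rcases vertex_or_edge hΓ y with ⟨a, rfl⟩ | ⟨a, b, hab, h⟩
  · exact ⟨a, by simp [support_vertex], by rw [vertexDist_vertex, coord_vertex_self]; ring⟩
  · have ha : a ∈ y.coord.support := by rw [← Finset.mem_coe, h]; simp
    have hb : b ∈ y.coord.support := by rw [← Finset.mem_coe, h]; simp
    rw [vertexDist_of_subset hab.ne h.le]
    have h1 := coord_add_of_subset hab.ne h.le
    rcases cast_dist_eq_add_one hΓ e hab with h2 | h2
    · refine ⟨b, hb, ?_⟩
      rw [h2, show y.coord b = 1 - y.coord a by linarith]; ring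
    · refine ⟨a, ha, ?_⟩
      rw [h2, show y.coord b = 1 - y.coord a by linarith]; ring

theorem abs_vertexDist_sub_le (hΓ : Γ.IsTree) {x : Realization Γ} {u : V}
    (hu : u ∈ x.coord.support) (v : V) : |vertexDist x v - Γ.dist u v| ≤ 1 - x.coord u := by
  rcases vertex_or_edge hΓ x with ⟨a, rfl⟩ | ⟨a, b, hab, h⟩
  · rw [support_vertex, Finset.mem_singleton] at hu
    subst hu
    rw [vertexDist_vertex, coord_vertex_self]; simp
  · have h1 := coord_add_of_subset hab.ne h.le
    have pa := x.nonneg a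
    have pb := x.nonneg b
    rw [vertexDist_of_subset hab.ne h.le]
    rw [← Finset.mem_coe, h] at hu
    have ha : x.coord a = 1 - x.coord b := by linarith
    rw [ha] at pa
    rcases hu with rfl | rfl <;> rcases cast_dist_eq_add_one hΓ v hab with h2 | h2 <;>
      rw [h2, ha, abs_le] <;> constructor <;> ring_nf <;> linarith

theorem dist_le_of_not_isClique {x y : Realization Γ}
    (h : ¬ Γ.IsClique ((x.coord.support : Set V) ∪ (y.coord.support : Set V))) {u v : V}
    (hu : u ∈ x.coord.support) (hv : v ∈ y.coord.support) :
    dist x y ≤ (1 - x.coord u) + (Γ.dist u v : ℝ) + (1 - y.coord v) := by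
  rw [dist_of_not_isClique h]
  refine csInf_le ⟨0, ?_⟩ ⟨u, hu, v, hv, rfl⟩
  rintro _ ⟨u, hu, v, hv, rfl⟩
  have := x.coord_le_one u
  have := y.coord_le_one v
  have : (0 : ℝ) ≤ Γ.dist u v := Nat.cast_nonneg _
  linarith

/-- Together with `exists_dist_le_vertexDist_sub` this writes `dist x y` as the maximum over `v` of
`vertexDist y v - vertexDist x v`. The metric axioms and the invariance under automorphisms are read
off from that formula. -/
theorem abs_vertexDist_sub_vertexDist_le (hΓ : Γ.IsTree) (x y : Realization Γ) (v : V) :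
    |vertexDist x v - vertexDist y v| ≤ dist x y := by
  by_cases hc : Γ.IsClique ((x.coord.support : Set V) ∪ (y.coord.support : Set V))
  · rcases eq_or_edge_of_isClique hΓ hc with rfl | ⟨a, b, hab, hx, hy⟩
    · rw [sub_self, abs_zero, dist_of_isClique hc]; simp
    · rw [dist_of_subset hab hx hy, vertexDist_of_subset hab.ne hx,
        vertexDist_of_subset hab.ne hy]
      have h1 := coord_add_of_subset hab.ne hx
      have h2 := coord_add_of_subset hab.ne hy
      have e1 : x.coord b = 1 - x.coord a := by linarith
      have e2 : y.coord b = 1 - y.coord a := by linarith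
      rcases cast_dist_eq_add_one hΓ v hab with h | h
      · rw [h, e1, e2]; ring_nf; rfl
      · rw [h, e1, e2, ← abs_neg (x.coord a - y.coord a)]; ring_nf; rfl
  · rw [dist_of_not_isClique hc]
    obtain ⟨u₀, hu₀⟩ := x.support_nonempty
    obtain ⟨v₀, hv₀⟩ := y.support_nonempty
    refine le_csInf ⟨_, u₀, hu₀, v₀, hv₀, rfl⟩ ?_
    rintro _ ⟨u, hu, w, hw, rfl⟩
    have h1 := abs_vertexDist_sub_le hΓ hu v
    have h2 := abs_vertexDist_sub_le hΓ hw v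
    have h3 : (Γ.dist u v : ℝ) ≤ Γ.dist u w + Γ.dist w v := by
      exact_mod_cast hΓ.connected.dist_triangle
    have h4 : (Γ.dist w v : ℝ) ≤ Γ.dist u w + Γ.dist u v := by
      rw [dist_comm (u := u) (v := w)]
      exact_mod_cast hΓ.connected.dist_triangle
    rw [abs_le] at *
    constructor <;> linarith

/-- Every segment `[y, x]` extends beyond `x` to a vertex. -/
theorem exists_dist_le_vertexDist_sub (hΓ : Γ.IsTree) (x y : Realization Γ) :
    ∃ e : V, dist x y ≤ vertexDist y e - vertexDist x e := by
  by_cases hc : Γ.IsClique ((x.coord.support : Set V) ∪ (y.coord.support : Set V))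
  · rcases eq_or_edge_of_isClique hΓ hc with rfl | ⟨a, b, hab, hx, hy⟩
    · obtain ⟨v, hv⟩ := x.support_nonempty
      refine ⟨v, ?_⟩
      rw [dist_of_isClique hc]; simp
    · rw [dist_of_subset hab hx hy]
      simp only [vertexDist_of_subset hab.ne hx, vertexDist_of_subset hab.ne hy]
      have h1 := coord_add_of_subset hab.ne hx
      have h2 := coord_add_of_subset hab.ne hy
      rcases le_total (x.coord a) (y.coord a) with h | h
      · refine ⟨b, ?_⟩
        rw [abs_of_nonpos (by linarith), dist_eq_one_iff_adj.2 hab, SimpleGraph.dist_self]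
        simp
      · refine ⟨a, ?_⟩
        rw [abs_of_nonneg (by linarith), dist_eq_one_iff_adj.2 hab.symm, SimpleGraph.dist_self]
        simp; linarith
  · rcases vertex_or_edge hΓ x with ⟨a, rfl⟩ | ⟨a, b, hab, h⟩
    · refine ⟨a, ?_⟩
      obtain ⟨v, hv, e⟩ := exists_vertexDist_eq hΓ y a
      have := dist_le_of_not_isClique hc (u := a) (by simp [support_vertex]) hv
      rw [coord_vertex_self] at this
      rw [vertexDist_vertex, SimpleGraph.dist_self, e, SimpleGraph.dist_comm]
      push_cast; linarith
    · have key : ∀ a b, Γ.Adj a b → (x.coord.support : Set V) = {a, b} →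
          (∀ v ∈ y.coord.support, Γ.dist v b = Γ.dist v a + 1) →
          dist x y ≤ vertexDist y b - vertexDist x b := by
        intro a b hab h hy
        obtain ⟨v, hv, e⟩ := exists_vertexDist_eq hΓ y b
        have ha : a ∈ x.coord.support := by rw [← Finset.mem_coe, h]; simp
        have h1 := dist_le_of_not_isClique hc ha hv
        rw [vertexDist_of_subset hab.ne h.le, SimpleGraph.dist_self,
          dist_eq_one_iff_adj.2 hab, e, hy v hv]
        rw [SimpleGraph.dist_comm] at h1
        push_cast; linarith
      -- An edge carrying `y` with ends on both sides of the edge `{a, b}` of `x` would be `{a, b}`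
      -- itself, which `hc` excludes.
      have hside : (∀ v ∈ y.coord.support, Γ.dist v b = Γ.dist v a + 1) ∨
          (∀ v ∈ y.coord.support, Γ.dist v a = Γ.dist v b + 1) := by
        rcases vertex_or_edge hΓ y with ⟨c, rfl⟩ | ⟨c, d, hcd, h'⟩
        · rw [support_vertex]
          simpa using (hΓ.dist_eq_dist_add_one_of_adj c hab).symm
        · have hmem : ∀ v, v ∈ y.coord.support ↔ v = c ∨ v = d := by
            intro v; rw [← Finset.mem_coe, h']; simp
          simp only [hmem, forall_eq_or_imp, forall_eq]
          have hcl : ∀ c d, (y.coord.support : Set V) = {c, d} → ¬ (c = a ∧ d = b) := by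
            rintro _ _ h'' ⟨rfl, rfl⟩
            apply hc
            rw [h, h'', Set.union_self]
            exact isClique_pair.2 fun _ => hab
          rcases hΓ.dist_eq_dist_add_one_of_adj c hab with h1 | h1 <;>
            rcases hΓ.dist_eq_dist_add_one_of_adj d hab with h2 | h2
          · exact Or.inr ⟨h1, h2⟩
          · exact absurd (hΓ.eq_of_adj_of_dist hab hcd.symm h2 h1)
              (hcl d c (by rw [h', Set.pair_comm]))
          · exact absurd (hΓ.eq_of_adj_of_dist hab hcd h1 h2) (hcl c d h')
          · exact Or.inl ⟨h1, h2⟩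
      rcases hside with hs | hs
      · exact ⟨b, key a b hab h hs⟩
      · exact ⟨a, key b a hab.symm (by rw [h, Set.pair_comm]) hs⟩

theorem exists_dist_eq_vertexDist_sub (hΓ : Γ.IsTree) (x y : Realization Γ) :
    ∃ e : V, dist x y = vertexDist y e - vertexDist x e := by
  obtain ⟨e, he⟩ := exists_dist_le_vertexDist_sub hΓ x y
  refine ⟨e, le_antisymm he ?_⟩
  have := abs_vertexDist_sub_vertexDist_le hΓ x y e
  rw [abs_sub_comm] at this
  exact (le_abs_self _).trans this

/-- If `u` carries `x`, then `vertexDist` at `u` is at most `1 - x.coord u < 1`. The end of `y`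
nearest to `u` is therefore `u` itself, and the two coordinates can be compared. -/
theorem coord_le_of_vertexDist_eq (hΓ : Γ.IsTree) {x y : Realization Γ}
    (h : ∀ v, vertexDist x v = vertexDist y v) (u : V) : x.coord u ≤ y.coord u := by
  by_cases hu : u ∈ x.coord.support
  · have h1 := abs_vertexDist_sub_le hΓ hu u
    obtain ⟨v, hv, e⟩ := exists_vertexDist_eq hΓ y u
    have h2 := coord_pos hu
    have h3 := y.coord_le_one v
    rw [SimpleGraph.dist_self, h u, e] at h1
    have h4 := (le_abs_self _).trans h1
    push_cast at h4
    have h5 : Γ.dist v u = 0 := by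
      have : (Γ.dist v u : ℝ) < 1 := by linarith
      have : Γ.dist v u < 1 := by exact_mod_cast this
      omega
    obtain rfl := hΓ.connected.dist_eq_zero_iff.1 h5
    rw [h5] at h4
    push_cast at h4
    linarith
  · rw [Finsupp.notMem_support_iff.1 hu]; exact y.nonneg u

/-- The realization of a tree as a metric space. -/
noncomputable instance metricSpace [hΓ : Fact Γ.IsTree] : MetricSpace (Realization Γ) where
  toDist := instDist
  dist_self x := by
    obtain ⟨e, he⟩ := exists_dist_eq_vertexDist_sub hΓ.out x x
    rw [he, sub_self]
  dist_comm x y := by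
    have key : ∀ x y : Realization Γ, dist x y ≤ dist y x := fun x y => by
      obtain ⟨e, he⟩ := exists_dist_eq_vertexDist_sub hΓ.out x y
      rw [he]
      exact (le_abs_self _).trans (abs_vertexDist_sub_vertexDist_le hΓ.out y x e)
    exact le_antisymm (key x y) (key y x)
  dist_triangle x y z := by
    obtain ⟨e, he⟩ := exists_dist_eq_vertexDist_sub hΓ.out x z
    have h1 := abs_vertexDist_sub_vertexDist_le hΓ.out x y e
    have h2 := abs_vertexDist_sub_vertexDist_le hΓ.out y z e
    rw [he]
    rw [abs_le] at h1 h2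
    linarith
  eq_of_dist_eq_zero {x y} h := by
    have hD : ∀ v, vertexDist x v = vertexDist y v := fun v => by
      have := abs_vertexDist_sub_vertexDist_le hΓ.out x y v
      rw [h] at this
      exact sub_eq_zero.1 (abs_nonpos_iff.1 this)
    ext u
    exact le_antisymm (coord_le_of_vertexDist_eq hΓ.out hD u)
      (coord_le_of_vertexDist_eq hΓ.out (fun v => (hD v).symm) u)

section Tree

variable [hΓ : Fact Γ.IsTree]

theorem dist_vertex (x : Realization Γ) (v : V) : dist x (vertex Γ v) = vertexDist x v := by
  refine le_antisymm ?_ ?_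
  · obtain ⟨e, he⟩ := exists_dist_le_vertexDist_sub hΓ.out (vertex Γ v) x
    rw [_root_.dist_comm, vertexDist_vertex] at he
    obtain ⟨u, hu, h1⟩ := exists_vertexDist_eq hΓ.out x v
    have h2 := abs_vertexDist_sub_le hΓ.out hu e
    have h3 : (Γ.dist u e : ℝ) ≤ Γ.dist u v + Γ.dist v e := by
      exact_mod_cast hΓ.out.connected.dist_triangle
    have := (le_abs_self _).trans h2
    linarith
  · have := abs_vertexDist_sub_vertexDist_le hΓ.out x (vertex Γ v) v
    rw [vertexDist_vertex, SimpleGraph.dist_self] at this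
    simpa using (le_abs_self _).trans this

theorem exists_btw_vertex (x y : Realization Γ) : ∃ e, IsRTree.Btw y x (vertex Γ e) := by
  obtain ⟨e, he⟩ := exists_dist_eq_vertexDist_sub hΓ.out x y
  refine ⟨e, ?_⟩
  rw [IsRTree.Btw, dist_vertex, dist_vertex, _root_.dist_comm, he]; ring

/-- Extending `[y, x]` beyond `x` to a vertex raises the left side by the added length and the right
side by at most as much. Doing this at all four points reduces the claim to vertices. -/
theorem realization_four_point (x y z w : Realization Γ) :
    dist x y + dist z w ≤ max (dist x z + dist y w) (dist x w + dist y z) := by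
  have ext : ∀ x y z w e : Realization Γ, IsRTree.Btw y x e →
      dist e y + dist z w ≤ max (dist e z + dist y w) (dist e w + dist y z) →
      dist x y + dist z w ≤ max (dist x z + dist y w) (dist x w + dist y z) := by
    intro x y z w e hb h
    unfold IsRTree.Btw at hb
    have t1 := dist_triangle e x z
    have t2 := dist_triangle e x w
    rw [_root_.dist_comm y x, _root_.dist_comm y e, _root_.dist_comm x e] at hb
    rcases le_max_iff.1 h with h | h
    · exact le_max_of_le_left (by linarith)
    · exact le_max_of_le_right (by linarith)
  have swap : ∀ x y z w : Realization Γ,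
      dist y x + dist z w ≤ max (dist y z + dist x w) (dist y w + dist x z) →
      dist x y + dist z w ≤ max (dist x z + dist y w) (dist x w + dist y z) := by
    intro x y z w h
    rwa [_root_.dist_comm x y, max_comm, add_comm (dist x w), add_comm (dist x z)]
  have flip : ∀ x y z w : Realization Γ,
      dist z w + dist x y ≤ max (dist z x + dist w y) (dist z y + dist w x) →
      dist x y + dist z w ≤ max (dist x z + dist y w) (dist x w + dist y z) := by
    intro x y z w h
    rwa [_root_.dist_comm x z, _root_.dist_comm y w, _root_.dist_comm x w,
      _root_.dist_comm y z, add_comm (dist x y), add_comm (dist w x)]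
  obtain ⟨a, ha⟩ := exists_btw_vertex x y
  obtain ⟨b, hb⟩ := exists_btw_vertex y (vertex Γ a)
  obtain ⟨c, hc⟩ := exists_btw_vertex z w
  obtain ⟨d, hd⟩ := exists_btw_vertex w (vertex Γ c)
  refine ext _ _ _ _ _ ha (swap _ _ _ _ (ext _ _ _ _ _ hb (flip _ _ _ _ (ext _ _ _ _ _ hc
    (swap _ _ _ _ (ext _ _ _ _ _ hd ?_))))))
  simp only [dist_vertex, vertexDist_vertex]
  exact_mod_cast hΓ.out.four_point d c b a

/-- Every number between `0` and `dist x y` is the distance from `x` of a point of `[x, y]`. -/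
def IsJoined (x y : Realization Γ) : Prop :=
  ∀ t : ℝ, 0 ≤ t → t ≤ dist x y → ∃ z, dist x z = t ∧ dist z y = dist x y - t

theorem isJoined_self (x : Realization Γ) : IsJoined x x := by
  intro t h0 h1
  rw [_root_.dist_self] at h1
  exact ⟨x, by rw [_root_.dist_self]; linarith, by linarith⟩

theorem IsJoined.trans {x y z : Realization Γ} (h : IsRTree.Btw x y z) (h1 : IsJoined x y)
    (h2 : IsJoined y z) : IsJoined x z := by
  intro t h0 ht
  unfold IsRTree.Btw at h
  rcases le_total t (dist x y) with hle | hle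
  · obtain ⟨w, e1, e2⟩ := h1 t h0 hle
    have t1 := dist_triangle w y z
    have t2 := dist_triangle x w z
    exact ⟨w, e1, by linarith⟩
  · obtain ⟨w, e1, e2⟩ := h2 (t - dist x y) (by linarith) (by linarith)
    have t1 := dist_triangle x y w
    have t2 := dist_triangle x w z
    exact ⟨w, by linarith, by linarith⟩

omit hΓ in
theorem isJoined_of_subset {x y : Realization Γ} {a b : V} (hab : Γ.Adj a b)
    (hx : (x.coord.support : Set V) ⊆ {a, b}) (hy : (y.coord.support : Set V) ⊆ {a, b}) :
    IsJoined x y := by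
  classical
  intro t h0 ht
  rw [dist_of_subset hab hx hy] at ht ⊢
  have hx0 := x.nonneg a
  have hx1 := x.coord_le_one a
  have hy0 := y.nonneg a
  have hy1 := y.coord_le_one a
  have hz : ∀ r h0 h1, ((edgePoint hab r h0 h1).coord.support : Set V) ⊆ {a, b} := by
    intro r h0 h1 v hv
    by_contra hne
    simp only [Set.mem_insert_iff, Set.mem_singleton_iff, not_or] at hne
    refine Finsupp.mem_support_iff.1 hv ?_
    simp [edgePoint, Ne.symm hne.1, Ne.symm hne.2]
  have ha : ∀ r h0 h1, (edgePoint hab r h0 h1).coord a = r := by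
    intro r h0 h1
    simp [edgePoint, hab.ne']
  rcases le_total (x.coord a) (y.coord a) with h | h
  · rw [abs_of_nonpos (by linarith)] at ht ⊢
    refine ⟨edgePoint hab (x.coord a + t) (by linarith) (by linarith), ?_, ?_⟩
    · rw [dist_of_subset hab hx (hz _ _ _), ha, abs_of_nonpos (by linarith)]; ring
    · rw [dist_of_subset hab (hz _ _ _) hy, ha, abs_of_nonpos (by linarith)]; ring
  · rw [abs_of_nonneg (by linarith)] at ht ⊢
    refine ⟨edgePoint hab (x.coord a - t) (by linarith) (by linarith), ?_, ?_⟩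
    · rw [dist_of_subset hab hx (hz _ _ _), ha, abs_of_nonneg (by linarith)]; ring
    · rw [dist_of_subset hab (hz _ _ _) hy, ha, abs_of_nonneg (by linarith)]; ring

theorem isJoined_vertex_of_mem {x : Realization Γ} {u : V} (hu : u ∈ x.coord.support) :
    IsJoined x (vertex Γ u) := by
  have hc : Γ.IsClique ((x.coord.support : Set V) ∪ ((vertex Γ u).coord.support : Set V)) := by
    rw [support_vertex, Finset.coe_singleton, Set.union_eq_left.2 (by simpa using hu)]
    exact x.clique
  rcases eq_or_edge_of_isClique hΓ.out hc with h | ⟨a, b, hab, h1, h2⟩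
  · rw [← h]; exact isJoined_self x
  · exact isJoined_of_subset hab h1 h2

theorem isJoined_vertex_vertex (u v : V) : IsJoined (vertex Γ u) (vertex Γ v) := by
  induction hn : Γ.dist u v generalizing u with
  | zero =>
    obtain rfl := hΓ.out.connected.dist_eq_zero_iff.1 hn
    exact isJoined_self _
  | succ n ih =>
    obtain ⟨w, hw, h⟩ := hΓ.out.connected.exists_adj_dist_eq hn
    refine IsJoined.trans ?_ (isJoined_of_subset hw ?_ ?_) (ih w h)
    · rw [IsRTree.Btw]
      simp only [dist_vertex, vertexDist_vertex]
      rw [dist_eq_one_iff_adj.2 hw, hn, h]; push_cast; ring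
    · simp [support_vertex]
    · simp [support_vertex]

theorem isJoined_vertex (x : Realization Γ) (e : V) : IsJoined x (vertex Γ e) := by
  obtain ⟨u, hu, h⟩ := exists_vertexDist_eq hΓ.out x e
  refine IsJoined.trans ?_ (isJoined_vertex_of_mem hu) (isJoined_vertex_vertex u e)
  have h1 := abs_vertexDist_sub_le hΓ.out hu u
  rw [SimpleGraph.dist_self] at h1
  push_cast at h1
  apply IsRTree.btw_of_le
  simp only [dist_vertex, vertexDist_vertex]
  have := (le_abs_self _).trans h1
  linarith

/-- The realization of a tree is a real tree. -/
instance isRTree : IsRTree (Realization Γ) where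
  four_point := realization_four_point
  exists_dist_eq x y t h0 ht := by
    -- The segment extends beyond `y` to a vertex `e`, and a point of `[x, e]` at distance at most
    -- `dist x y` from `x` lies on `[x, y]`.
    obtain ⟨e, he⟩ := exists_btw_vertex y x
    unfold IsRTree.Btw at he
    obtain ⟨z, h1, h2⟩ := isJoined_vertex x e t h0
      (by linarith [dist_nonneg (x := y) (y := vertex Γ e)])
    refine ⟨z, h1, ?_⟩
    have t1 := dist_triangle x z y
    have k := realization_four_point x (vertex Γ e) y z
    rw [_root_.dist_comm (vertex Γ e) z, _root_.dist_comm (vertex Γ e) y,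
      _root_.dist_comm y z] at k
    rcases le_max_iff.1 k with k | k <;> linarith

theorem vertexDist_smul (φ : Γ ≃g Γ) (x : Realization Γ) (v : V) :
    vertexDist (φ • x) (φ v) = vertexDist x v := by
  change (x.coord.equivMapDomain φ.toEquiv).sum _ = _
  rw [Finsupp.equivMapDomain_eq_mapDomain, Finsupp.sum_mapDomain_index (by simp)
    (fun _ _ _ => add_mul _ _ _)]
  refine Finsupp.sum_congr fun u _ => ?_
  change _ * (Γ.dist (φ u) (φ v) : ℝ) = _
  rw [hΓ.out.connected.dist_map_iso]

theorem realization_dist_smul (φ : Γ ≃g Γ) (x y : Realization Γ) :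
    dist (φ • x) (φ • y) = dist x y := by
  refine le_antisymm ?_ ?_
  · obtain ⟨e, he⟩ := exists_dist_eq_vertexDist_sub hΓ.out (φ • x) (φ • y)
    obtain ⟨e, rfl⟩ := φ.surjective e
    rw [he, vertexDist_smul, vertexDist_smul, _root_.dist_comm x y]
    exact (le_abs_self _).trans (abs_vertexDist_sub_vertexDist_le hΓ.out y x e)
  · obtain ⟨e, he⟩ := exists_dist_eq_vertexDist_sub hΓ.out x y
    rw [he, ← vertexDist_smul φ x, ← vertexDist_smul φ y, _root_.dist_comm (φ • x)]
    exact (le_abs_self _).trans (abs_vertexDist_sub_vertexDist_le hΓ.out _ _ _)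

instance isIsometricSMul : IsIsometricSMul (Γ ≃g Γ) (Realization Γ) where
  isometry_smul φ := Isometry.of_dist_eq (realization_dist_smul φ)

instance nonempty : Nonempty (Realization Γ) :=
  hΓ.out.connected.nonempty.map (vertex Γ)

end Tree

end Realization
end TreeQM

/-! ### From copies in the circuit to chains along the axis -/

namespace TreeQM

open IsRTree

variable {V : Type*} {Γ : SimpleGraph V} [hΓ : Fact Γ.IsTree]

theorem translationLength_eq {φ : Γ ≃g Γ} {p : Realization Γ} (hp : p ∈ Ax (Realization Γ) φ) :
    translationLength φ = dist p (φ • p) :=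
  IsLeast.csInf_eq ⟨⟨p, rfl⟩, by rintro _ ⟨y, rfl⟩; exact dist_le_of_mem_Ax hp y⟩

theorem charSubtree_eq (φ : Γ ≃g Γ) : charSubtree φ = Ax (Realization Γ) φ := by
  obtain ⟨p, hp, -⟩ := exists_mem_Ax φ (Classical.arbitrary (Realization Γ))
  ext x
  refine ⟨fun h => mem_Ax_of_dist_le hp ?_, fun h => (translationLength_eq h).symm⟩
  rw [← translationLength_eq hp]
  exact (show dist x (φ • x) = _ from h).le

theorem isHyperbolic_iff {φ : Γ ≃g Γ} {p : Realization Γ} (hp : p ∈ Ax (Realization Γ) φ) :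
    IsHyperbolic φ ↔ φ • p ≠ p := by
  rw [IsHyperbolic, translationLength_eq hp, dist_pos, ne_comm]

omit hΓ in
theorem proj_eq_proj_iff {φ : Γ ≃g Γ} {x y : Realization Γ} :
    proj φ x = proj φ y ↔ ∃ k : ℤ, φ ^ k • y = x := by
  unfold proj
  rw [Quotient.eq, MulAction.orbitRel_apply, MulAction.mem_orbit_iff]
  constructor
  · rintro ⟨⟨_, k, rfl⟩, h⟩
    exact ⟨k, h⟩
  · rintro ⟨k, h⟩
    exact ⟨⟨φ ^ k, k, rfl⟩, h⟩

/-- A unit speed parametrization of the axis of `φ`, on which `φ` acts as the shift by `L`. -/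
structure AxisLine (φ : Γ ≃g Γ) (L : ℝ) where
  toFun : ℝ → Realization Γ
  isometry : Isometry toFun
  shift : ∀ t, toFun (t + L) = φ • toFun t
  range_eq : Set.range toFun = Ax (Realization Γ) φ
  pos : 0 < L

namespace AxisLine

variable {φ : Γ ≃g Γ} {L : ℝ} (l : AxisLine φ L)

theorem dist_eq (a b : ℝ) : dist (l.toFun a) (l.toFun b) = |a - b| := by
  rw [l.isometry.dist_eq, Real.dist_eq]

theorem mem_Ax (a : ℝ) : l.toFun a ∈ Ax (Realization Γ) φ := l.range_eq ▸ ⟨a, rfl⟩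

theorem exists_eq {x : Realization Γ} (hx : x ∈ Ax (Realization Γ) φ) : ∃ a, l.toFun a = x := by
  rwa [← l.range_eq] at hx

theorem translationLength_eq (l : AxisLine φ L) : translationLength φ = L := by
  rw [TreeQM.translationLength_eq (l.mem_Ax 0), ← l.shift, l.dist_eq]
  simp [l.pos.le]

theorem shift_zpow (k : ℤ) (t : ℝ) : l.toFun (t + k * L) = φ ^ k • l.toFun t := by
  induction k using Int.induction_on with
  | zero => simp
  | succ n ih =>
    rw [add_comm (n : ℤ), zpow_add, mul_smul, ← ih, zpow_one, ← l.shift]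
    push_cast; ring_nf
  | pred n ih =>
    rw [sub_eq_add_neg, add_comm (-(n : ℤ)), zpow_add, mul_smul, ← ih, zpow_neg_one,
      eq_inv_smul_iff, ← l.shift]
    push_cast; ring_nf

theorem proj_eq_iff {a b : ℝ} :
    proj φ (l.toFun a) = proj φ (l.toFun b) ↔ ∃ k : ℤ, a = b + k * L := by
  rw [proj_eq_proj_iff]
  simp only [← l.shift_zpow]
  constructor
  · rintro ⟨k, h⟩; exact ⟨k, (l.isometry.injective h).symm⟩
  · rintro ⟨k, h⟩; exact ⟨k, by rw [h]⟩

theorem geodesic_eq (a b : ℝ) :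
    geodesic (l.toFun a) (l.toFun b) = l.toFun '' Set.uIcc a b := by
  ext x
  constructor
  · intro hx
    obtain ⟨r, rfl⟩ := l.exists_eq (Ax_convex (l.mem_Ax a) (l.mem_Ax b) hx)
    refine ⟨r, ?_, rfl⟩
    have h : |a - r| + |r - b| = |a - b| := by
      rw [← l.dist_eq, ← l.dist_eq, ← l.dist_eq]; exact hx
    rw [Set.mem_uIcc]
    rcases abs_cases (a - r) with h1 | h1 <;> rcases abs_cases (r - b) with h2 | h2 <;>
      rcases abs_cases (a - b) with h3 | h3 <;>
      first
        | exact Or.inl ⟨by linarith, by linarith⟩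
        | exact Or.inr ⟨by linarith, by linarith⟩
  · rintro ⟨r, hr, rfl⟩
    change dist _ _ + dist _ _ = dist _ _
    simp only [l.dist_eq]
    rcases Set.mem_uIcc.1 hr with ⟨h1, h2⟩ | ⟨h1, h2⟩
    · rw [abs_of_nonpos (by linarith), abs_of_nonpos (by linarith),
        abs_of_nonpos (by linarith)]; ring
    · rw [abs_of_nonneg (by linarith), abs_of_nonneg (by linarith),
        abs_of_nonneg (by linarith)]; ring

theorem exists_of_btw {a b : ℝ} (hab : a ≤ b) {x : Realization Γ}
    (h : Btw (l.toFun a) x (l.toFun b)) : ∃ r, a ≤ r ∧ r ≤ b ∧ l.toFun r = x := by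
  have h' : x ∈ geodesic (l.toFun a) (l.toFun b) := h
  rw [l.geodesic_eq, Set.uIcc_of_le hab] at h'
  obtain ⟨r, hr, e⟩ := h'
  exact ⟨r, hr.1, hr.2, e⟩

theorem btw_of_le {a b c : ℝ} (hab : a ≤ b) (hbc : b ≤ c) :
    Btw (l.toFun a) (l.toFun b) (l.toFun c) := by
  have : l.toFun b ∈ geodesic (l.toFun a) (l.toFun c) := by
    rw [l.geodesic_eq, Set.uIcc_of_le (hab.trans hbc)]
    exact ⟨b, ⟨hab, hbc⟩, rfl⟩
  exact this

variable {R : Realization Γ → Realization Γ → Prop} {m : ℝ}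

/-- On the axis a chain amounts to a finite `m`-separated set of starting parameters;
`chain_of_finset` is the converse. -/
theorem exists_finset_of_chain (hm0 : 0 < m) (hm : ∀ s t, R s t → dist s t = m) {n : ℕ}
    {a b : ℝ} (hab : a ≤ b) (h : Chain R n (l.toFun a) (l.toFun b)) :
    ∃ U : Finset ℝ, U.card = n ∧
      (∀ t ∈ U, R (l.toFun t) (l.toFun (t + m)) ∧ a ≤ t ∧ t + m ≤ b) ∧
      ∀ t ∈ U, ∀ t' ∈ U, t < t' → t + m ≤ t' := by
  classical
  induction n generalizing b with
  | zero => exact ⟨∅, by simp⟩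
  | succ n ih =>
    obtain ⟨s, t, hR, hc, h1, h2⟩ := h
    obtain ⟨σ, ha, hb, rfl⟩ := l.exists_of_btw hab h1
    obtain ⟨τ, hσ, hτ, rfl⟩ := l.exists_of_btw hb h2
    obtain rfl : τ = σ + m := by
      have := hm _ _ hR
      rw [l.dist_eq, abs_of_nonpos (by linarith)] at this
      linarith
    obtain ⟨U, hcard, hU, hsep⟩ := ih ha hc
    have hnot : σ ∉ U := fun h => by linarith [(hU σ h).2.2]
    refine ⟨insert σ U, by rw [Finset.card_insert_of_notMem hnot, hcard], ?_, ?_⟩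
    · intro t ht
      rcases Finset.mem_insert.1 ht with rfl | ht
      · exact ⟨hR, ha, hτ⟩
      · obtain ⟨k1, k2, k3⟩ := hU t ht
        exact ⟨k1, k2, by linarith⟩
    · intro t ht t' ht' hlt
      rcases Finset.mem_insert.1 ht with h1 | ht <;>
        rcases Finset.mem_insert.1 ht' with h2 | ht'
      · exact absurd hlt (by rw [h1, h2]; exact lt_irrefl _)
      · linarith [(hU t' ht').2.2]
      · rw [h2]; exact (hU t ht).2.2
      · exact hsep t ht t' ht' hlt

theorem chain_of_finset (hm0 : 0 < m) {a b : ℝ} (U : Finset ℝ)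
    (hU : ∀ t ∈ U, R (l.toFun t) (l.toFun (t + m)) ∧ a ≤ t ∧ t + m ≤ b)
    (hsep : ∀ t ∈ U, ∀ t' ∈ U, t < t' → t + m ≤ t') :
    Chain R U.card (l.toFun a) (l.toFun b) := by
  classical
  induction U using Finset.induction_on_max generalizing b with
  | empty => trivial
  | insert c U hc ih =>
    rw [Finset.card_insert_of_notMem fun h => lt_irrefl _ (hc c h)]
    obtain ⟨k1, k2, k3⟩ := hU c (Finset.mem_insert_self c U)
    refine ⟨l.toFun c, l.toFun (c + m), k1, ih (fun t ht => ?_) (fun t ht t' ht' => ?_),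
      l.btw_of_le k2 (by linarith), l.btw_of_le (by linarith) k3⟩
    · have := hU t (Finset.mem_insert_of_mem ht)
      exact ⟨this.1, this.2.1, hsep t (Finset.mem_insert_of_mem ht) c
        (Finset.mem_insert_self c U) (hc t ht)⟩
    · exact hsep t (Finset.mem_insert_of_mem ht) t' (Finset.mem_insert_of_mem ht')

/-- The arc of length `m` of the circuit that starts at parameter `t`. -/
def arc (m t : ℝ) : Set (CyclicQuotient φ) := proj φ '' (l.toFun '' Set.Icc t (t + m))

theorem mem_arc_iff {t r : ℝ} :
    proj φ (l.toFun r) ∈ l.arc m t ↔ ∃ a ∈ Set.Icc t (t + m), ∃ k : ℤ, a = r + k * L := by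
  constructor
  · rintro ⟨_, ⟨a, ha, rfl⟩, h⟩
    exact ⟨a, ha, l.proj_eq_iff.1 h⟩
  · rintro ⟨a, ha, hk⟩
    exact ⟨_, ⟨a, ha, rfl⟩, l.proj_eq_iff.2 hk⟩

theorem arc_add_mul (t : ℝ) (k : ℤ) : l.arc m (t + k * L) = l.arc m t := by
  have key : ∀ (t : ℝ) (k : ℤ), l.arc m t ⊆ l.arc m (t + k * L) := by
    rintro t k _ ⟨_, ⟨a, ha, rfl⟩, rfl⟩
    rw [mem_arc_iff]
    exact ⟨a + k * L, ⟨by linarith [ha.1], by linarith [ha.2]⟩, k, rfl⟩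
  refine Set.Subset.antisymm ?_ (key t k)
  have := key (t + k * L) (-k)
  rwa [show t + k * L + ((-k : ℤ) : ℝ) * L = t by push_cast; ring] at this

theorem overlap_of_lt {t t' : ℝ} (h : t ≤ t') (h' : t' < t + m) :
    Overlap φ (l.arc m t) (l.arc m t') := by
  refine ⟨l.toFun t', l.toFun (t + m), fun e => h'.ne (l.isometry.injective e), ?_, ?_⟩
  · rw [charSubtree_eq, l.geodesic_eq, ← l.range_eq]
    exact Set.image_subset_range _ _
  · rw [l.geodesic_eq, Set.uIcc_of_le h'.le]
    refine Set.subset_inter ?_ ?_ <;> refine Set.image_mono (Set.image_mono ?_)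
    · exact Set.Icc_subset_Icc h le_rfl
    · exact Set.Icc_subset_Icc le_rfl (by linarith)

theorem not_overlap {t t' : ℝ} (h0 : 0 ≤ t) (h1 : t + m ≤ t') (h2 : t' + m ≤ L) :
    ¬ Overlap φ (l.arc m t) (l.arc m t') := by
  rintro ⟨p, q, hpq, hsub, himg⟩
  rw [charSubtree_eq] at hsub
  obtain ⟨c, rfl⟩ := l.exists_eq (hsub (btw_left p q))
  obtain ⟨d, rfl⟩ := l.exists_eq (hsub (btw_right _ q))
  -- Lifts `a`, `a'` of a common point to the two arcs satisfy `0 ≤ a' - a ≤ L`, so either both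
  -- equal `t'`, or they are `0` and `L`. Common points thus have parameters in two countable sets,
  -- whereas a non-trivial interval has positive measure.
  have hcount : (Set.uIcc c d).Countable := by
    refine Set.Countable.mono (s₂ := Set.range (fun k : ℤ => t' - k * L) ∪
      Set.range fun k : ℤ => (k : ℝ) * L) ?_
      ((Set.countable_range _).union (Set.countable_range _))
    intro r hr
    have hmem : proj φ (l.toFun r) ∈ l.arc m t ∩ l.arc m t' :=
      himg ⟨_, by rw [l.geodesic_eq]; exact ⟨r, hr, rfl⟩, rfl⟩
    obtain ⟨a, ha, k, hk⟩ := l.mem_arc_iff.1 hmem.1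
    obtain ⟨a', ha', k', hk'⟩ := l.mem_arc_iff.1 hmem.2
    obtain ⟨ha1, ha2⟩ := ha
    obtain ⟨ha1', ha2'⟩ := ha'
    have e : a' - a = (k' - k : ℤ) * L := by rw [hk, hk']; push_cast; ring
    have hL := l.pos
    have b1 : (-1 : ℝ) < (k' - k : ℤ) := by
      by_contra! hcon
      nlinarith
    have b2 : ((k' - k : ℤ) : ℝ) < 2 := by
      by_contra! hcon
      nlinarith
    have b1' : -1 < k' - k := by exact_mod_cast b1
    have b2' : k' - k < 2 := by exact_mod_cast b2
    obtain hz | hz : k' - k = 0 ∨ k' - k = 1 := by omega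
    · left
      rw [hz] at e
      refine ⟨k', ?_⟩
      push_cast at e
      simp only
      linarith
    · right
      rw [hz] at e
      refine ⟨-k, ?_⟩
      push_cast at e ⊢
      linarith
  have := hcount.measure_zero MeasureTheory.volume
  rw [Real.volume_interval, ENNReal.ofReal_eq_zero] at this
  exact hpq (by rw [sub_eq_zero.1 (abs_nonpos_iff.1 this)])

end AxisLine

variable {G : Type*} [Group G]

/-- The pair `(s, t)` is a translate of the oriented segment `γ`. -/
def IsTranslate (ρ : G →* (Γ ≃g Γ)) (γ : OrientedSegment Γ) (s t : Realization Γ) : Prop :=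
  ∃ k : G, s = ρ k • γ.source ∧ t = ρ k • γ.target

omit hΓ in
theorem IsTranslate.smul {ρ : G →* (Γ ≃g Γ)} {γ : OrientedSegment Γ} (g : G)
    {s t : Realization Γ} (h : IsTranslate ρ γ s t) :
    IsTranslate ρ γ (ρ g • s) (ρ g • t) := by
  obtain ⟨k, rfl, rfl⟩ := h
  exact ⟨g * k, by rw [map_mul, mul_smul], by rw [map_mul, mul_smul]⟩

theorem IsTranslate.dist_eq {ρ : G →* (Γ ≃g Γ)} {γ : OrientedSegment Γ}
    {s t : Realization Γ} (h : IsTranslate ρ γ s t) : dist s t = γ.length := by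
  obtain ⟨k, rfl, rfl⟩ := h
  exact dist_smul _ _ _

omit hΓ in
theorem isTranslate_reverse (ρ : G →* (Γ ≃g Γ)) (γ : OrientedSegment Γ) :
    IsTranslate ρ γ.reverse = fun s t => IsTranslate ρ γ t s := by
  funext s t
  exact propext (exists_congr fun k => and_comm)

variable {ρ : G →* (Γ ≃g Γ)} {γ : OrientedSegment Γ} {g : G} {L : ℝ}

theorem isPositiveCopy_iff (l : AxisLine (ρ g) L) {A : Set (CyclicQuotient (ρ g))} :
    IsPositiveCopy ρ γ g A ↔ γ.length ≤ L ∧ ∃ t : ℝ,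
      IsTranslate ρ γ (l.toFun t) (l.toFun (t + γ.length)) ∧ A = l.arc γ.length t := by
  have hm0 : 0 ≤ γ.length := dist_nonneg
  have hgeo : ∀ t, geodesic (l.toFun t) (l.toFun (t + γ.length)) =
      l.toFun '' Set.Icc t (t + γ.length) := fun t => by
    rw [l.geodesic_eq, Set.uIcc_of_le (by linarith)]
  unfold IsPositiveCopy
  rw [l.translationLength_eq]
  refine and_congr_right fun hle => ⟨?_, ?_⟩
  · rintro ⟨k, ⟨hsub, n, hn⟩, rfl⟩
    rw [charSubtree_eq] at hsub
    obtain ⟨s, hs⟩ := l.exists_eq (hsub (btw_left _ _))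
    obtain ⟨t, ht⟩ := l.exists_eq (hsub (btw_right _ _))
    rw [← hs, ← ht, ← zpow_natCast, ← l.shift_zpow, l.geodesic_eq, Set.uIcc_of_le (by
      have := mul_nonneg (Nat.cast_nonneg (α := ℝ) n) l.pos.le
      push_cast; linarith)] at hn
    obtain ⟨t', ht', e⟩ := hn
    obtain rfl := l.isometry.injective e
    have hd : dist (l.toFun s) (l.toFun t') = γ.length := by
      rw [hs, ht]; exact dist_smul _ _ _
    rw [l.dist_eq, abs_of_nonpos (by linarith [ht'.1])] at hd
    obtain rfl : t' = s + γ.length := by linarith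
    refine ⟨s, ⟨k, hs, ht⟩, ?_⟩
    rw [AxisLine.arc, ← hgeo, hs, ht]
    rfl
  · rintro ⟨t, ⟨k, hs, ht⟩, rfl⟩
    have hcar : (γ.translate (ρ k)).carrier = l.toFun '' Set.Icc t (t + γ.length) := by
      rw [← hgeo, hs, ht]; rfl
    -- One period is enough, because the segment is not longer than `L`.
    refine ⟨k, ⟨?_, 1, ?_⟩, by rw [hcar]; rfl⟩
    · rw [hcar, charSubtree_eq, ← l.range_eq]
      exact Set.image_subset_range _ _
    · change ρ k • γ.target ∈ geodesic (ρ k • γ.source) (ρ g ^ 1 • ρ k • γ.source)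
      rw [← hs, ← ht, pow_one, ← l.shift]
      exact l.btw_of_le (by linarith) (by linarith)

/-- A chain in one period projects to non-overlapping copies. Conversely, copies lift to starting
parameters in `[0, L)`, and only the one that starts last can run past `L`; the others form a chain.
-/
theorem le_copyCount_and_copyCount_le (l : AxisLine (ρ g) L) (hm0 : 0 < γ.length) :
    count (IsTranslate ρ γ) (l.toFun 0) (l.toFun L) ≤ copyCount ρ γ g ∧
      copyCount ρ γ g ≤ count (IsTranslate ρ γ) (l.toFun 0) (l.toFun L) + 1 := by
  classical
  have hm : ∀ s t, IsTranslate ρ γ s t → dist s t = γ.length := fun s t h => h.dist_eq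
  have hyp : IsHyperbolic (ρ g) := by rw [IsHyperbolic, l.translationLength_eq]; exact l.pos
  have hub : ∀ n ∈ {n : ℕ | ∃ S : Finset (Set (CyclicQuotient (ρ g))), S.card = n ∧
      (∀ A ∈ S, IsPositiveCopy ρ γ g A) ∧
      ∀ A ∈ S, ∀ B ∈ S, A ≠ B → ¬ Overlap (ρ g) A B},
      n ≤ count (IsTranslate ρ γ) (l.toFun 0) (l.toFun L) + 1 := by
    rintro n ⟨S, rfl, hS, hdis⟩
    have hex : ∀ A ∈ S, ∃ t : ℝ, (0 ≤ t ∧ t < L) ∧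
        IsTranslate ρ γ (l.toFun t) (l.toFun (t + γ.length)) ∧ A = l.arc γ.length t := by
      intro A hA
      obtain ⟨-, t, hR, rfl⟩ := (isPositiveCopy_iff l).1 (hS A hA)
      have hfl := Int.floor_le (t / L)
      have hlt := Int.lt_floor_add_one (t / L)
      rw [le_div_iff₀ l.pos] at hfl
      rw [div_lt_iff₀ l.pos] at hlt
      refine ⟨t + (-⌊t / L⌋ : ℤ) * L, ⟨?_, ?_⟩, ?_, (l.arc_add_mul t _).symm⟩
      · push_cast; linarith
      · push_cast; linarith
      · rw [add_right_comm, l.shift_zpow, l.shift_zpow, ← map_zpow]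
        exact hR.smul _
    choose! τ hτ using hex
    have hinj : Set.InjOn τ S := fun A hA B hB e => by
      rw [(hτ A hA).2.2, (hτ B hB).2.2, e]
    have hsep : ∀ t ∈ S.image τ, ∀ t' ∈ S.image τ, t < t' → t + γ.length ≤ t' := by
      simp only [Finset.mem_image]
      rintro _ ⟨A, hA, rfl⟩ _ ⟨B, hB, rfl⟩ hlt
      by_contra! hcon
      have := l.overlap_of_lt hlt.le hcon
      rw [← (hτ A hA).2.2, ← (hτ B hB).2.2] at this
      exact hdis A hA B hB (fun e => hlt.ne (by rw [e])) this
    rw [← Finset.card_image_of_injOn hinj]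
    rcases (S.image τ).eq_empty_or_nonempty with he | hne
    · rw [he]; simp
    · set M := (S.image τ).max' hne with hM
      have hMmem : M ∈ S.image τ := Finset.max'_mem _ _
      have hMlt : M < L := by
        obtain ⟨A, hA, e⟩ := Finset.mem_image.1 hMmem
        rw [← e]; exact (hτ A hA).1.2
      have hch := l.chain_of_finset (R := IsTranslate ρ γ) hm0 (a := 0) (b := L)
        ((S.image τ).erase M) (fun t ht => ?_)
        (fun t ht t' ht' => hsep t (Finset.mem_of_mem_erase ht) t' (Finset.mem_of_mem_erase ht'))
      · have := hch.le_count hm0 hm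
        rw [Finset.card_erase_of_mem hMmem] at this
        omega
      · have htM : t < M := lt_of_le_of_ne (Finset.le_max' _ _ (Finset.mem_of_mem_erase ht))
          (Finset.ne_of_mem_erase ht)
        have h1 := hsep t (Finset.mem_of_mem_erase ht) M hMmem htM
        obtain ⟨A, hA, rfl⟩ := Finset.mem_image.1 (Finset.mem_of_mem_erase ht)
        exact ⟨(hτ A hA).2.1, (hτ A hA).1.1, by linarith⟩
  rw [copyCount, if_pos hyp]
  refine ⟨le_csSup ⟨_, hub⟩ ?_, csSup_le ⟨0, ∅, by simp⟩ hub⟩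
  obtain ⟨U, hcard, hU, hsep⟩ := l.exists_finset_of_chain hm0 hm l.pos.le
    (chain_count hm0 hm (l.toFun 0) (l.toFun L))
  have hno : ∀ t ∈ U, ∀ t' ∈ U, t ≠ t' →
      ¬ Overlap (ρ g) (l.arc γ.length t) (l.arc γ.length t') := by
    intro t ht t' ht' hne
    rcases lt_or_gt_of_ne hne with hlt | hlt
    · exact l.not_overlap (hU t ht).2.1 (hsep t ht t' ht' hlt) (hU t' ht').2.2
    · rintro ⟨p, q, h1, h2, h3⟩
      exact l.not_overlap (hU t' ht').2.1 (hsep t' ht' t ht hlt) (hU t ht).2.2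
        ⟨p, q, h1, h2, by rwa [Set.inter_comm]⟩
  refine ⟨U.image (l.arc γ.length), ?_, ?_, ?_⟩
  · rw [← hcard]
    refine Finset.card_image_of_injOn fun t ht t' ht' e => ?_
    by_contra hne
    -- An arc of positive length overlaps itself, so different parameters give different copies.
    refine hno t ht t' ht' hne ?_
    have e' : l.arc γ.length t = l.arc γ.length t' := e
    rw [← e']
    exact l.overlap_of_lt le_rfl (by linarith)
  · intro A hA
    obtain ⟨t, ht, rfl⟩ := Finset.mem_image.1 hA
    obtain ⟨h1, h2, h3⟩ := hU t ht
    exact (isPositiveCopy_iff l).2 ⟨by linarith, t, h1, rfl⟩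
  · intro A hA B hB hne
    obtain ⟨t, ht, rfl⟩ := Finset.mem_image.1 hA
    obtain ⟨t', ht', rfl⟩ := Finset.mem_image.1 hB
    exact hno t ht t' ht' fun e => hne (by rw [e])

/-- Both orientations exceed their counts along one period by `0` or `1`, so the difference is off
by at most `1`, wherever the circuit is cut. -/
theorem abs_countingFn_sub_le (hm0 : 0 < γ.length) {x : Realization Γ}
    (hx : x ∈ Ax (Realization Γ) (ρ g)) :
    (ρ g • x = x → countingFn ρ γ g = 0) ∧
      |countingFn ρ γ g - signedCount (IsTranslate ρ γ) x (ρ g • x)| ≤ 1 := by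
  have hzero : ρ g • x = x → countingFn ρ γ g = 0 := by
    intro h
    have : ¬ IsHyperbolic (ρ g) := by rw [isHyperbolic_iff hx]; simpa using h
    simp [countingFn, copyCount, this]
  refine ⟨hzero, ?_⟩
  by_cases hfix : ρ g • x = x
  · rw [hzero hfix, hfix, signedCount_self]; simp
  · obtain ⟨f, h1, h2, h3, h4⟩ := exists_line hx hfix
    let l : AxisLine (ρ g) (dist x (ρ g • x)) := ⟨f, h1, h3, h4, dist_pos.2 (Ne.symm hfix)⟩
    have e0 : l.toFun 0 = x := h2
    have e1 : l.toFun (dist x (ρ g • x)) = ρ g • x := by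
      have := l.shift 0
      rwa [zero_add, e0] at this
    have hrev : γ.reverse.length = γ.length := dist_comm _ _
    obtain ⟨k1, k2⟩ := le_copyCount_and_copyCount_le (γ := γ) l hm0
    obtain ⟨k3, k4⟩ := le_copyCount_and_copyCount_le (γ := γ.reverse) l (by rwa [hrev])
    rw [isTranslate_reverse, count_flip hm0 fun s t (h : IsTranslate ρ γ s t) => h.dist_eq]
      at k3 k4
    rw [e0, e1] at k1 k2 k3 k4
    rw [← Nat.cast_le (α := ℝ)] at k1 k2 k3 k4
    push_cast at k1 k2 k3 k4
    unfold countingFn signedCount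
    rw [abs_le]; constructor <;> linarith

omit hΓ in
theorem defect_le {f : G → ℝ} {D : ℝ} (h : DefectBound f D) :
    IsQuasimorphism f ∧ defect f ≤ D :=
  ⟨⟨D, h⟩, csInf_le ⟨0, fun _ hD => (abs_nonneg _).trans (hD 1 1)⟩ h⟩

end TreeQM

theorem mainTheorem4 {V : Type*} (Γ : SimpleGraph V) (hΓ : Γ.IsTree)
    {G : Type*} [Group G] (ρ : G →* (Γ ≃g Γ))
    (noInversion : ∀ (g : G) (u v : V), Γ.Adj u v → ¬ (ρ g u = v ∧ ρ g v = u))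
    (γ : TreeQM.OrientedSegment Γ) :
    (TreeQM.IsQuasimorphism (TreeQM.countingFn ρ γ) ∧
      TreeQM.defect (TreeQM.countingFn ρ γ) ≤ 6) ∧
    (∀ g : G, Filter.Tendsto (fun n : ℕ => TreeQM.countingFn ρ γ (g ^ n) / (n : ℝ))
      Filter.atTop (nhds (TreeQM.homogenizedFn ρ γ g))) ∧
    (TreeQM.IsQuasimorphism (TreeQM.homogenizedFn ρ γ) ∧
      TreeQM.defect (TreeQM.homogenizedFn ρ γ) ≤ 6) := by
  have : Fact Γ.IsTree := ⟨hΓ⟩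
  -- For a degenerate segment the lengths of chains need not be bounded, but then `γ` equals its
  -- reverse and the counting function vanishes.
  rcases (dist_nonneg : 0 ≤ γ.length).eq_or_lt with hm | hm
  · have hrev : γ.reverse = γ := by
      have e : γ.source = γ.target := dist_eq_zero.1 hm.symm
      cases γ
      simp only at e
      subst e
      rfl
    have hf : ∀ g, TreeQM.countingFn ρ γ g = 0 := fun g => by
      rw [TreeQM.countingFn, hrev, sub_self]
    have hlim : ∀ g : G, Filter.Tendsto (fun n : ℕ => TreeQM.countingFn ρ γ (g ^ n) / (n : ℝ))
        Filter.atTop (nhds 0) := fun g => by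
      simp only [hf, zero_div]; exact tendsto_const_nhds
    have hh : ∀ g, TreeQM.homogenizedFn ρ γ g = 0 := fun g => (hlim g).limUnder_eq
    refine ⟨TreeQM.defect_le fun g h => ?_, fun g => ?_, TreeQM.defect_le fun g h => ?_⟩
    · simp [hf]
    · rw [hh]; exact hlim g
    · simp [hh]
  · let _ : MulAction G (TreeQM.Realization Γ) := MulAction.compHom _ ρ
    have : IsIsometricSMul G (TreeQM.Realization Γ) := ⟨fun g => isometry_smul _ (ρ g)⟩
    have hR : ∀ (g : G) s t, TreeQM.IsTranslate ρ γ s t →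
        TreeQM.IsTranslate ρ γ (g • s) (g • t) := fun g s t h => h.smul g
    have hd : ∀ s t, TreeQM.IsTranslate ρ γ s t → dist s t = γ.length :=
      fun s t h => h.dist_eq
    have hf : ∀ g, TreeQM.IsRTree.Approximates (TreeQM.IsTranslate ρ γ) g
        (TreeQM.countingFn ρ γ g) := fun g x hx => TreeQM.abs_countingFn_sub_le hm hx
    have hlim := TreeQM.IsRTree.exists_tendsto_approximates hR hm hd hf
    have ht : ∀ g : G, Filter.Tendsto (fun n : ℕ => TreeQM.countingFn ρ γ (g ^ n) / (n : ℝ))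
        Filter.atTop (nhds (TreeQM.homogenizedFn ρ γ g)) := fun g =>
      tendsto_nhds_limUnder ((hlim g).imp fun _ h => h.1)
    have hh : ∀ g, TreeQM.IsRTree.Approximates (TreeQM.IsTranslate ρ γ) g
        (TreeQM.homogenizedFn ρ γ g) := fun g => by
      obtain ⟨r, h1, h2⟩ := hlim g
      rwa [tendsto_nhds_unique (ht g) h1]
    exact ⟨TreeQM.defect_le fun g h => (hf g).abs_mul_sub_le_six hR hm hd (hf h) (hf (g * h)),
      ht, TreeQM.defect_le fun g h => (hh g).abs_mul_sub_le_six hR hm hd (hh h) (hh (g * h))⟩
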